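/- **Conventions.** Semilattices are nonempty meet-semilattices $L$; a join $x\vee y$ (a least upper bound) need not exist. A poset has finite rank if the lengths of its chains are bounded. A semilattice $L$ is *modular* if every principal ideal of $L$ is a modular lattice and $x\vee y\vee z$ exists whenever $x\vee y$, $y\vee z$, $z\vee x$ exist. An element $l\in L$ is *join-irreducible* if it is not the minimum of $L$ and $l=a\vee b$ implies $l=a$ or $l=b$; $L^{\mathrm{ir}}$ is the poset of join-irreducible elements. An *ideal* of a poset is a downward closed subset (possibly empty). Let $P$ be a poset. An *inconsistency relation* on $P$ is a symmetric relation $\smile$ such that $p\smile q$ implies that $p,q$ have no common upper bound, and $p\smile q$, $p\le p'$, $q\le q'$ imply $p'\smile q'$. A set without a pair $x\smile y$ is *consistent*. A *collinearity relation* on $P$ is a symmetric ternary relation $C$ such that $C(p,q,r)$ implies that $p,q,r$ are pairwise incomparable, and $C(p,q,r)$, $p\le w$, $q\le w$ imply $r\le w$. A poset with such $\smile$ and $C$ is a *PPIP* if: * (Regularity) if $C(p,q,r)$, $r'\le r$, $r'\not\le p$, $r'\not\le q$, then $C(p',q',r')$ for some $p'\le p$, $q'\le q$; * (weak Triangle)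 if $C(a,c,p)$, $C(b,c,q)$ and $\{a,b,c,p,q\}$ is consistent, then at least one of the following holds: (i) there is $x$ with $C(a,b,x)$ and $C(p,q,x)$ such that $a,b,c,p,q,x$ are pairwise incomparable and the only collinear triples among them are $(a,c,p),(b,c,q),(a,b,x),(p,q,x)$ and their permutations; (ii) $C(b,q,a')$ for some $a'\le a$; (iii) $C(b,q,p)$; (iv) $C(q,a',p')$ for some $a'\le a$, $p'\le p$; (v) $q\le a$ or $q\le p$; * (Consistent-Collinearity) if $C(p,q,r)$, then $\{p,q,r\}$ is consistent, and every $x\in P$ is consistent with all of $p,q,r$ or with at most one of them. A *subspace* of $P$ is an ideal $X$ such that $p,q\in X$ and $C(p,q,r)$ imply $r\in X$. $\mathrm{Csub}(P)$ is the family of consistent subspaces of $P$, ordered by inclusion. For a semilattice $L$, $\mathrm{PPIP}(L)$ is the poset $L^{\mathrm{ir}}$ with the relations: $x\smile y$ iff $x\vee y$ does not exist in $L$; $C(x,y,z)$ iff $x,y,z$ are pairwise incomparable, $x\vee y,y\vee z,z\vee x$ exist in $L$, and $x\vee y=y\vee z=z\vee x$. **Theorem.** 1. Let $L$ be a modular semilattice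 of finite rank. Then $\mathrm{PPIP}(L)$ is a PPIP of finite rank, and $\phi(l)=\{p\in \mathrm{PPIP}(L)\mid p\le l\}$ defines an order isomorphism $\phi\colon L\to \mathrm{Csub}(\mathrm{PPIP}(L))$. Its inverse is $\psi(I)=\bigvee_{x\in I}x$, with $\psi(\emptyset)=\min L$. 2. Let $P$ be a PPIP whose underlying poset has finite rank. Then $\mathrm{Csub}(P)$ is a modular semilattice, and $p\mapsto I_p=\{p'\in P\mid p'\le p\}$ is an isomorphism from $P$ onto $\mathrm{PPIP}(\mathrm{Csub}(P))$, that is, an order isomorphism that preserves and reflects $\smile$ and $C$. -/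

import Mathlib

universe u v

namespace PPIP

/-! ### Modular semilattices -/

/-- The partial order of `α` is the order of a modular lattice. -/
def IsModularLatticeOrder (α : Type u) [h : PartialOrder α] : Prop :=
  ∃ I : Lattice α, I.toPartialOrder = h ∧ @IsModularLattice α I

/-- The (nonempty) poset `L` is a modular (meet-)semilattice: binary meets exist, every principal
ideal is a modular lattice, and `x ∨ y ∨ z` exists as soon as `x ∨ y`, `y ∨ z`, `z ∨ x` exist. -/
structure IsModularSemilattice (L : Type u) [PartialOrder L] : Prop where
  nonempty : Nonempty L
  exists_inf : ∀ x y : L, ∃ m, IsGLB {x, y} m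
  principal_modular : ∀ l : L, IsModularLatticeOrder (Set.Iic l)
  exists_sup₃ : ∀ x y z : L, (∃ s, IsLUB {x, y} s) → (∃ s, IsLUB {y, z} s) →
    (∃ s, IsLUB {z, x} s) → ∃ s, IsLUB {x, y, z} s

/-- A poset has finite rank if the lengths of its chains are bounded by a natural number. -/
def FiniteRank (α : Type u) [PartialOrder α] : Prop :=
  Order.krullDim α < ⊤

/-! ### Inconsistency and collinearity relations -/

section Relations

variable {P : Type u} [PartialOrder P]

/-- Two elements of a poset are incomparable. -/
def Incomp (p q : P) : Prop := ¬ p ≤ q ∧ ¬ q ≤ p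

/-- `inc` is an inconsistency relation on the poset `P`. -/
structure IsInconsistencyRel (inc : P → P → Prop) : Prop where
  symm : ∀ p q, inc p q → inc q p
  /-- inconsistent elements have no common upper bound -/
  ic1 : ∀ p q, inc p q → ¬ ∃ w, p ≤ w ∧ q ≤ w
  ic2 : ∀ p q p' q', inc p q → p ≤ p' → q ≤ q' → inc p' q'

/-- `C` is a collinearity relation on the poset `P`. Its invariance under all permutations of the
three arguments is expressed through a transposition and a 3-cycle. -/
structure IsCollinearityRel (C : P → P → P → Prop) : Prop where
  swap : ∀ p q r, C p q r → C q p r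
  rotate : ∀ p q r, C p q r → C q r p
  ct1 : ∀ p q r, C p q r → Incomp p q ∧ Incomp q r ∧ Incomp r p
  ct2 : ∀ p q r w, C p q r → p ≤ w → q ≤ w → r ≤ w

/-- A set is consistent if it contains no inconsistent pair. -/
def Consistent (inc : P → P → Prop) (X : Set P) : Prop :=
  ∀ x ∈ X, ∀ y ∈ X, ¬ inc x y

/-- The regularity axiom. -/
def Regularity (C : P → P → P → Prop) : Prop :=
  ∀ p q r r', C p q r → r' ≤ r → ¬ r' ≤ p → ¬ r' ≤ q →
    ∃ p' q', p' ≤ p ∧ q' ≤ q ∧ C p' q' r'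

/-- The elements `a, b, c, p, q, x` form a triangle configuration: `C a b x` and `C p q x` hold,
the six elements are pairwise incomparable, and the only collinear triples among them are
`(a, c, p)`, `(b, c, q)`, `(a, b, x)`, `(p, q, x)` and their permutations. -/
def TriangleConfiguration (C : P → P → P → Prop) (a b c p q x : P) : Prop :=
  C a b x ∧ C p q x ∧
  [a, b, c, p, q, x].Pairwise Incomp ∧
  ∀ u ∈ [a, b, c, p, q, x], ∀ v ∈ [a, b, c, p, q, x], ∀ w ∈ [a, b, c, p, q, x], C u v w →
    ({u, v, w} : Set P) = {a, c, p} ∨ ({u, v, w} : Set P) = {b, c, q} ∨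
    ({u, v, w} : Set P) = {a, b, x} ∨ ({u, v, w} : Set P) = {p, q, x}

/-- The five alternatives in the conclusion of the (weak) triangle axiom. -/
def TriangleAlternatives (C : P → P → P → Prop) (a b c p q : P) : Prop :=
  (∃ x, TriangleConfiguration C a b c p q x) ∨
  (∃ a', a' ≤ a ∧ C b q a') ∨
  C b q p ∨
  (∃ a' p', a' ≤ a ∧ p' ≤ p ∧ C q a' p') ∨
  (q ≤ a ∨ q ≤ p)

/-- The weak triangle axiom. -/
def WeakTriangle (inc : P → P → Prop) (C : P → P → P → Prop) : Prop :=
  ∀ a b c p q, C a c p → C b c q → Consistent inc {a, b, c, p, q} →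
    TriangleAlternatives C a b c p q

/-- The poset `P` with the relations `inc` and `C` is a PPIP (projective poset with inconsistent
pairs). -/
structure IsPPIP (inc : P → P → Prop) (C : P → P → P → Prop) : Prop where
  inconsistency : IsInconsistencyRel inc
  collinearity : IsCollinearityRel C
  regularity : Regularity C
  weakTriangle : WeakTriangle inc C
  cc1 : ∀ p q r, C p q r → Consistent inc {p, q, r}
  /-- each `x` is consistent with all or with at most one of the members of a collinear triple -/
  cc2 : ∀ p q r, C p q r → ∀ x,
    (∀ y ∈ ({p, q, r} : Set P), ¬ inc x y) ∨ {y ∈ ({p, q, r} : Set P) | ¬ inc x y}.Subsingleton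

/-- `X` is a subspace: an ideal closed under collinearity. -/
def IsSubspace (C : P → P → P → Prop) (X : Set P) : Prop :=
  IsLowerSet X ∧ ∀ p ∈ X, ∀ q ∈ X, ∀ r, C p q r → r ∈ X

/-- The family of consistent subspaces, ordered by inclusion (as a subtype of `Set P`). -/
abbrev Csub (inc : P → P → Prop) (C : P → P → P → Prop) : Type u :=
  {X : Set P // IsSubspace C X ∧ Consistent inc X}

end Relations

/-! ### The structure induced on the join-irreducible elements -/

section Irreducibles

/-- `l` is join-irreducible: it is not the minimum, and `l = a ∨ b` implies `l = a` or `l = b`.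
Joins are least upper bounds, which need not exist. -/
def IsJoinIrred {L : Type u} [PartialOrder L] (l : L) : Prop :=
  ¬ IsBot l ∧ ∀ a b, IsLUB {a, b} l → l = a ∨ l = b

/-- The join-irreducible elements of `L`, with the order induced from `L`. -/
abbrev Irr (L : Type u) [PartialOrder L] : Type u := {l : L // IsJoinIrred l}

variable {L : Type u} [PartialOrder L]

/-- The induced inconsistency relation: `x ∨ y` does not exist in `L`. -/
def irrInc (x y : Irr L) : Prop :=
  ¬ ∃ s : L, IsLUB {x.1, y.1} s

/-- The induced collinearity relation: `x, y, z` are pairwise incomparable, and the joins `x ∨ y`,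
`y ∨ z`, `z ∨ x` exist in `L` and are equal. -/
def irrColl (x y z : Irr L) : Prop :=
  (Incomp x y ∧ Incomp y z ∧ Incomp z x) ∧
  ∃ s : L, IsLUB {x.1, y.1} s ∧ IsLUB {y.1, z.1} s ∧ IsLUB {z.1, x.1} s

end Irreducibles

end PPIP

/-!
The proof rests on one description of joins, valid on both sides of the correspondence: a
join-irreducible element (a point) lies below a join `x ∨ y` exactly when it lies below `x`, below
`y`, or on a line that connects a point below `x` to a point below `y`.

*From semilattices to PPIPs.* A join exists as soon as there is an upper bound, so all the axioms
concern modular lattices, namely principal ideals. If `r` is join-irreducible, then `q ⊔ r` is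
join-irreducible in the interval `[q, q ⊔ r]` (`le_or_le_of_supIrred_of_le_sup`); this transport
of irreducibility along perspectivities gives the description of joins
(`exists_supIrred_of_le_sup`) and hence regularity. For the triangle axiom let `t`, `s` be the lines
through `a, c, p` and through `b, c, q`. If `q ≤ t`, `p ≤ s` or `c ≤ a ⊔ b`, then one of the
degenerate alternatives holds; otherwise `(a ⊔ b) ⊓ (p ⊔ q)` contains an irreducible `x` not
below `t` or `s` (`exists_supIrred_off_lines`), which completes the configuration. That every
consistent subspace `I` is of the form `{p | p ≤ m}` follows because the elements whose irreducibles all lie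
in `I` form a directed set, which has a greatest element by finite rank.

*From PPIPs to semilattices.* Inside a consistent subspace, the weak triangle axiom, applied so
that all its alternatives end in `r`, shows that the union of the lines between two subspaces is
again a subspace (`IsPPIP.isSubspace_joinSet`), and with this formula modularity is immediate. Spans
of consistent sets are consistent, because the elements consistent with a given one form a
subspace; this yields the existence of triple joins. A principal ideal is clearly irreducible.
For the converse, collinearity does not increase the height beyond the maximum
(`IsPPIP.height_le_max`). So in a consistent subspace `X` with `p ∈ X` of maximal height, there is
a subspace `Z` maximal among those that contain all elements of smaller height and avoid `p`, and
`X` is the join of `Z` and the principal ideal of `p` (`IsPPIP.exists_eq_principal`).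
-/

namespace PPIP

/-! ### Join-irreducible elements of modular lattices -/

section ModularLattice

variable {M : Type u} [Lattice M] [IsModularLattice M]

lemma le_inf_sup_of_le {b u v z : M} (hvz : v ≤ z) (hb : b ≤ u ⊔ v) (hbz : b ≤ z) :
    b ≤ u ⊓ z ⊔ v := by
  rw [sup_comm, ← sup_inf_assoc_of_le u hvz, sup_comm]
  exact le_inf hb hbz

/-- If `r` is join-irreducible, then `q ⊔ r` is join-irreducible in the interval `[q, q ⊔ r]`. -/
lemma le_or_le_of_supIrred_of_le_sup {q r x y : M} (hr : SupIrred r) (hqx : q ≤ x) (hqy : q ≤ y)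
    (hx : x ≤ q ⊔ r) (hy : y ≤ q ⊔ r) (h : r ≤ x ⊔ y) : r ≤ x ∨ r ≤ y := by
  have hx' : x = q ⊔ r ⊓ x := by rw [← sup_inf_assoc_of_le r hqx, inf_eq_right.2 hx]
  have hy' : y = q ⊔ r ⊓ y := by rw [← sup_inf_assoc_of_le r hqy, inf_eq_right.2 hy]
  set w := r ⊓ x ⊔ r ⊓ y with hw
  have hwr : w ≤ r := sup_le inf_le_left inf_le_left
  have h1 : r ≤ w ⊔ q := by
    refine h.trans (sup_le ?_ ?_)
    · rw [hx']; exact sup_le le_sup_right (le_sup_left.trans le_sup_left)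
    · rw [hy']; exact sup_le le_sup_right (le_sup_right.trans le_sup_left)
  have h2 : q ⊓ r ≤ w := (le_inf inf_le_right (inf_le_left.trans hqx)).trans le_sup_left
  have h3 : w = r := by
    have := sup_inf_assoc_of_le q hwr
    rw [inf_eq_right.2 h1, sup_eq_left.2 h2] at this
    exact this.symm
  rcases hr.2 h3 with h | h
  · exact Or.inl (inf_eq_left.1 h)
  · exact Or.inr (inf_eq_left.1 h)

/-- A point `b` outside `t` that `x ≤ a ⊔ b` reaches with the help of `t ≥ a` is already reached
with the help of `a`. -/
lemma le_sup_of_supIrred_of_le_sup {a b t x : M} (hb : SupIrred b) (hat : a ≤ t)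
    (hx : x ≤ a ⊔ b) (hbt : ¬ b ≤ t) (h : b ≤ x ⊔ t) : b ≤ x ⊔ a := by
  set y := x ⊔ a with hy
  have hy' : y = a ⊔ b ⊓ y := by
    rw [← sup_inf_assoc_of_le b (le_sup_right : a ≤ y), inf_eq_right.2 (sup_le hx le_sup_left)]
  have h1 : b ≤ b ⊓ y ⊔ t := by
    refine h.trans (sup_le ?_ le_sup_right)
    refine (le_sup_left : x ≤ y).trans ?_
    calc y = a ⊔ b ⊓ y := hy'
      _ ≤ b ⊓ y ⊔ t := sup_le (hat.trans le_sup_right) le_sup_left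
  have h2 := sup_inf_assoc_of_le t (inf_le_left : b ⊓ y ≤ b)
  rw [inf_eq_right.2 h1] at h2
  rcases hb.2 h2.symm with h | h
  · exact inf_eq_left.1 h
  · exact absurd (inf_eq_right.1 h) hbt

/-- A minimal `x ≤ x₀` with `b ≤ x ⊔ t` is join-irreducible: `t ⊔ b` is join-irreducible in
`[t, t ⊔ b]`. -/
lemma exists_minimal_supIrred [WellFoundedLT M] {b t x₀ : M} (hb : SupIrred b) (hbt : ¬ b ≤ t)
    (hx : x₀ ≤ t ⊔ b) (h : b ≤ x₀ ⊔ t) :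
    ∃ x ≤ x₀, SupIrred x ∧ b ≤ x ⊔ t ∧ ∀ y ≤ x, b ≤ y ⊔ t → y = x := by
  obtain ⟨x, ⟨hxx, hbx⟩, hmin⟩ :=
    WellFounded.has_min (wellFounded_lt (α := M)) {x | x ≤ x₀ ∧ b ≤ x ⊔ t} ⟨x₀, le_rfl, h⟩
  have hmin' : ∀ y ≤ x, b ≤ y ⊔ t → y = x := fun y hy hby => by
    by_contra hne
    exact hmin y ⟨hy.trans hxx, hby⟩ (lt_of_le_of_ne hy hne)
  refine ⟨x, hxx, ⟨fun hm => hbt ?_, fun y z hyz => ?_⟩, hbx, hmin'⟩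
  · exact hbx.trans (sup_le (hm.isBot t) le_rfl)
  · have hyx : y ≤ x := hyz ▸ le_sup_left
    have hzx : z ≤ x := hyz ▸ le_sup_right
    have hle : ∀ w ≤ x, w ⊔ t ≤ t ⊔ b := fun w hw => sup_le ((hw.trans hxx).trans hx) le_sup_left
    have h' : b ≤ (y ⊔ t) ⊔ (z ⊔ t) := by rw [← sup_sup_distrib_right, hyz]; exact hbx
    rcases le_or_le_of_supIrred_of_le_sup hb le_sup_right le_sup_right (hle y hyx) (hle z hzx) h'
      with h | h
    · exact Or.inl (hmin' y hyx h)
    · exact Or.inr (hmin' z hzx h)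

/-- An irreducible `r ≤ x ⊔ y` lies on a line that joins a point below `x` to a point below `y`. -/
lemma exists_supIrred_of_le_sup [WellFoundedLT M] {r x y : M} (hr : SupIrred r) (h : r ≤ x ⊔ y)
    (hrx : ¬ r ≤ x) (hry : ¬ r ≤ y) :
    ∃ p ≤ x, ∃ q ≤ y, SupIrred p ∧ SupIrred q ∧ r ≤ p ⊔ q ∧ p ≤ q ⊔ r ∧ q ≤ r ⊔ p := by
  obtain ⟨p, hpx, hp, hrp, hmin⟩ := exists_minimal_supIrred (x₀ := x ⊓ (y ⊔ r)) hr hry inf_le_right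
    (le_inf_sup_of_le le_sup_left h le_sup_right)
  have hrp' : ¬ r ≤ p := fun h => hrx ((h.trans hpx).trans inf_le_left)
  obtain ⟨q, hqy, hq, hrq, -⟩ := exists_minimal_supIrred (x₀ := y ⊓ (p ⊔ r)) hr hrp' inf_le_right
    (le_inf_sup_of_le le_sup_left (by rwa [sup_comm]) le_sup_right)
  refine ⟨p, hpx.trans inf_le_left, q, hqy.trans inf_le_left, hp, hq, sup_comm p q ▸ hrq, ?_,
    sup_comm p r ▸ hqy.trans inf_le_right⟩
  -- By minimality of `p`, the element `p ⊓ (q ⊔ r)` is `p` itself.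
  refine inf_eq_left.1 (hmin (p ⊓ (q ⊔ r)) inf_le_left ?_)
  exact (le_inf_sup_of_le le_sup_left (sup_comm p q ▸ hrq) le_sup_right).trans
    (sup_le_sup_left (hqy.trans inf_le_left) _)

section Triangle

variable {a b c p q s t : M}

/-- In a triangle with lines `t = a ⊔ c = c ⊔ p = p ⊔ a` and `s = b ⊔ c = c ⊔ q = q ⊔ b`, if
`p ≤ s` while `q` is not below `t`, then one of `p`, `a` is collinear with `b` and `q`. -/
lemma sup_eq_line_of_le_line (hc : SupIrred c) (hq : SupIrred q)
    (hat : a ≤ t) (hpt : p ≤ t) (hac : c ≤ p ⊔ a) (hct : t ≤ c ⊔ p) (hbs : b ≤ s)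
    (hcs : c ≤ s) (hqs : q ≤ s) (hbc : s ≤ b ⊔ c) (hcq : s ≤ c ⊔ q) (hqb : s ≤ q ⊔ b)
    (hqt : ¬ q ≤ t) (hps : p ≤ s) :
    (s ≤ b ⊔ p ∧ s ≤ q ⊔ p) ∨ (s ≤ b ⊔ a ∧ s ≤ q ⊔ a) := by
  have hts : t ≤ s := hct.trans (sup_le hcs hps)
  have has : a ≤ s := hat.trans hts
  have hb' : s ≤ b ⊔ p ∨ s ≤ b ⊔ a := by
    have h : c ≤ (b ⊔ p) ⊔ (b ⊔ a) := hac.trans (sup_le_sup le_sup_right le_sup_right)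
    rcases le_or_le_of_supIrred_of_le_sup hc le_sup_left le_sup_left
      ((sup_le hbs hps).trans hbc) ((sup_le hbs has).trans hbc) h with h | h
    · exact Or.inl (hbc.trans (sup_le le_sup_left h))
    · exact Or.inr (hbc.trans (sup_le le_sup_left h))
  have hq' : s ≤ q ⊔ p ∨ s ≤ q ⊔ a := by
    have h : c ≤ (q ⊔ p) ⊔ (q ⊔ a) := hac.trans (sup_le_sup le_sup_right le_sup_right)
    rw [sup_comm c q] at hcq
    rcases le_or_le_of_supIrred_of_le_sup hc le_sup_left le_sup_left
      ((sup_le hqs hps).trans hcq) ((sup_le hqs has).trans hcq) h with h | h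
    · exact Or.inl (hcq.trans (sup_le le_sup_left h))
    · exact Or.inr (hcq.trans (sup_le le_sup_left h))
  rcases hb' with h1 | h1 <;> rcases hq' with h2 | h2
  · exact Or.inl ⟨h1, h2⟩
  · -- `s = a ⊔ q`, so `s` is irreducible over `a`, and `s = (a ⊔ b) ⊔ t`.
    rw [sup_comm q a] at h2
    have h : q ≤ (a ⊔ b) ⊔ t := hqs.trans (h1.trans
      (sup_le (le_sup_right.trans le_sup_left) (hpt.trans le_sup_right)))
    rcases le_or_le_of_supIrred_of_le_sup hq le_sup_left hat
      ((sup_le has hbs).trans h2) (hts.trans h2) h with h | h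
    · refine Or.inr ⟨?_, by rwa [sup_comm]⟩
      rw [sup_comm b a]
      exact hqb.trans (sup_le h le_sup_right)
    · exact absurd h hqt
  · rw [sup_comm q p] at h2
    have h : q ≤ (p ⊔ b) ⊔ t := hqs.trans (h1.trans
      (sup_le (le_sup_right.trans le_sup_left) (hat.trans le_sup_right)))
    rcases le_or_le_of_supIrred_of_le_sup hq le_sup_left hpt
      ((sup_le hps hbs).trans h2) (hts.trans h2) h with h | h
    · refine Or.inl ⟨?_, by rwa [sup_comm]⟩
      rw [sup_comm b p]
      exact hqb.trans (sup_le h le_sup_right)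
    · exact absurd h hqt
  · exact Or.inr ⟨h1, h2⟩

/-- In a triangle with lines `t = a ⊔ c` and `s = b ⊔ c = c ⊔ q = q ⊔ b`, if `c ≤ a ⊔ b` while
`b` is not below `t`, then some irreducible below `a` is collinear with `b` and `q`. -/
lemma exists_collinear_of_le_sup [WellFoundedLT M] (hb : SupIrred b) (hq : SupIrred q)
    (hat : a ≤ t) (hct : c ≤ t) (hta : t ≤ a ⊔ c) (hbs : b ≤ s) (hqs : q ≤ s)
    (hbc : s ≤ b ⊔ c) (hcq : s ≤ c ⊔ q) (hqb : s ≤ q ⊔ b) (hnbq : ¬ b ≤ q) (hnqb : ¬ q ≤ b)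
    (hbt : ¬ b ≤ t) (h : c ≤ a ⊔ b) :
    ∃ a' ≤ a, SupIrred a' ∧ a' ≤ s ∧ s ≤ b ⊔ a' ∧ s ≤ q ⊔ a' := by
  have hs : s ≤ a ⊔ b := hbc.trans (sup_le le_sup_right h)
  have ht : t ≤ a ⊔ b := hta.trans (sup_le le_sup_left h)
  -- `a ⊔ b` is irreducible over `a`, and it is the join of `t` and `a ⊔ q`.
  have hbaq : b ≤ a ⊔ q := by
    rcases le_or_le_of_supIrred_of_le_sup hb hat (le_sup_left : a ≤ a ⊔ q) ht
      (sup_le le_sup_left (hqs.trans hs))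
      (hbs.trans (hcq.trans (sup_le_sup hct le_sup_right))) with h | h
    · exact absurd h hbt
    · exact h
  obtain ⟨a₁, ha₁, hi₁, hq₁, -⟩ := exists_minimal_supIrred (x₀ := a ⊓ s) hq hnqb
    (inf_le_right.trans (hqb.trans (sup_comm q b).le))
    (le_inf_sup_of_le hbs (hqs.trans hs) hqs)
  obtain ⟨a₂, ha₂, hi₂, hb₂, -⟩ := exists_minimal_supIrred (x₀ := a ⊓ s) hb hnbq
    (inf_le_right.trans hqb) (le_inf_sup_of_le hqs hbaq hbs)
  have hs₁ : s ≤ a₁ ⊔ b := hqb.trans (sup_le hq₁ le_sup_right)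
  have has₁ : a₁ ≤ s := ha₁.trans inf_le_right
  have has₂ : a₂ ≤ s := ha₂.trans inf_le_right
  refine ⟨a₁, ha₁.trans inf_le_left, hi₁, has₁, by rwa [sup_comm], ?_⟩
  -- `s = a₁ ⊔ b` is irreducible over `a₁`, and it is the join of `a₁ ⊔ q` and `a₁ ⊔ a₂`.
  rcases le_or_le_of_supIrred_of_le_sup hb (le_sup_left : a₁ ≤ a₁ ⊔ q)
    (le_sup_left : a₁ ≤ a₁ ⊔ a₂) ((sup_le has₁ hqs).trans hs₁) ((sup_le has₁ has₂).trans hs₁)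
    (hb₂.trans (sup_le (le_sup_right.trans le_sup_right) (le_sup_right.trans le_sup_left)))
    with h | h
  · exact hqb.trans (sup_le le_sup_left (h.trans (sup_comm a₁ q).le))
  · exact absurd (((h.trans (sup_le (ha₁.trans inf_le_left) (ha₂.trans inf_le_left)))).trans hat)
      hbt

/-- In a triangle with lines `t` through `a, c, p` and `s` through `b, c, q`, the meet of the lines
`a ⊔ b` and `p ⊔ q` contains an irreducible that generates `t ⊔ b` over `t` and `s ⊔ a` over `s`. -/
lemma exists_supIrred_off_lines [WellFoundedLT M] (ha : SupIrred a) (hb : SupIrred b)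
    (hp : SupIrred p) (hq : SupIrred q)
    (hat : a ≤ t) (hct : c ≤ t) (hpt : p ≤ t) (hac : t ≤ a ⊔ c) (hcp : t ≤ c ⊔ p)
    (hpa : t ≤ p ⊔ a) (hbs : b ≤ s) (hcs : c ≤ s) (hqs : q ≤ s) (hbc : s ≤ b ⊔ c)
    (hcq : s ≤ c ⊔ q) (hqb : s ≤ q ⊔ b)
    (has : ¬ a ≤ s) (hps : ¬ p ≤ s) (hbt : ¬ b ≤ t) (hqt : ¬ q ≤ t) (hcab : ¬ c ≤ a ⊔ b) :
    ∃ x, SupIrred x ∧ x ≤ a ⊔ b ∧ x ≤ p ⊔ q ∧ b ≤ x ⊔ t ∧ a ≤ x ⊔ s := by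
  have hst : s ≤ t ⊔ b := hbc.trans (sup_le le_sup_right (hct.trans le_sup_left))
  have hts : t ≤ s ⊔ a := hac.trans (sup_le le_sup_right (hcs.trans le_sup_left))
  have hbx : b ≤ (a ⊔ b) ⊓ (p ⊔ q) ⊔ t := by
    have h1 : b ≤ (p ⊔ q) ⊔ a := hbs.trans (hcq.trans (sup_le
      (hct.trans (hpa.trans (sup_le (le_sup_left.trans le_sup_left) le_sup_right)))
      (le_sup_right.trans le_sup_left)))
    have := le_inf_sup_of_le (le_sup_left : a ≤ a ⊔ b) h1 le_sup_right
    rw [inf_comm] at this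
    exact this.trans (sup_le_sup_left hat _)
  have hax : a ≤ (a ⊔ b) ⊓ (p ⊔ q) ⊔ s := by
    have h1 : a ≤ (p ⊔ q) ⊔ b := hat.trans (hcp.trans (sup_le
      (hcs.trans (hqb.trans (sup_le (le_sup_right.trans le_sup_left) le_sup_right)))
      (le_sup_left.trans le_sup_left)))
    have := le_inf_sup_of_le (le_sup_right : b ≤ a ⊔ b) h1 le_sup_left
    rw [inf_comm] at this
    exact this.trans (sup_le_sup_left hbs _)
  obtain ⟨x, hx, hxi, hbx, -⟩ := exists_minimal_supIrred hb hbt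
    (inf_le_left.trans (sup_le_sup_right hat _)) hbx
  obtain ⟨y, hy, hyi, hay, -⟩ := exists_minimal_supIrred ha has
    (inf_le_left.trans (sup_le (le_sup_right) (hbs.trans le_sup_left))) hax
  have hxu := hx.trans inf_le_left
  have hxv := hx.trans inf_le_right
  have hyu := hy.trans inf_le_left
  have hyv := hy.trans inf_le_right
  by_cases h : b ≤ y ⊔ t
  · exact ⟨y, hyi, hyu, hyv, h, hay⟩
  exfalso
  -- Otherwise `p ⊔ q = y ⊔ q` is irreducible over `y`; it is the join of `y ⊔ x` and `y ⊔ p`.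
  have hpy : p ≤ y ⊔ q := le_sup_of_supIrred_of_le_sup hp hqs (hyv.trans (sup_comm p q).le) hps
    (hpt.trans (hts.trans (sup_le le_sup_right hay)))
  have hqx : q ≤ x ⊔ p := le_sup_of_supIrred_of_le_sup hq hpt hxv hqt
    (hqs.trans (hst.trans (sup_le le_sup_right hbx)))
  rcases le_or_le_of_supIrred_of_le_sup hq (le_sup_left : y ≤ y ⊔ x) (le_sup_left : y ≤ y ⊔ p)
    (sup_le le_sup_left (hxv.trans (sup_le hpy le_sup_right))) (sup_le le_sup_left hpy)
    (hqx.trans (sup_le_sup le_sup_right le_sup_right)) with hq' | hq'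
  · exact hcab (hcs.trans (hqb.trans (sup_le (hq'.trans (sup_le hyu hxu)) le_sup_right)))
  · exact h (hbs.trans (hcq.trans (sup_le (hct.trans le_sup_right)
      (hq'.trans (sup_le_sup_left hpt _)))))

end Triangle

end ModularLattice

/-! ### Collinearity in modular lattice orders -/

section Collinear

/-- Elements of a poset are collinear if they are pairwise incomparable and their pairwise joins
exist and agree. -/
def Collinear {α : Type u} [PartialOrder α] (x y z : α) : Prop :=
  (Incomp x y ∧ Incomp y z ∧ Incomp z x) ∧
    ∃ s : α, IsLUB {x, y} s ∧ IsLUB {y, z} s ∧ IsLUB {z, x} s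

lemma isJoinIrred_iff_supIrred {M : Type u} [Lattice M] {x : M} :
    IsJoinIrred x ↔ SupIrred x := by
  unfold IsJoinIrred SupIrred
  refine and_congr (not_congr ⟨IsBot.isMin, IsMin.isBot⟩) ⟨fun h a b hab => ?_, fun h a b hab => ?_⟩
  · rcases h a b (hab ▸ isLUB_pair) with h | h
    exacts [Or.inl h.symm, Or.inr h.symm]
  · rcases h (isLUB_pair.unique hab) with h | h
    exacts [Or.inl h.symm, Or.inr h.symm]

lemma collinear_iff {M : Type u} [Lattice M] {x y z : M} :
    Collinear x y z ↔ (Incomp x y ∧ Incomp y z ∧ Incomp z x) ∧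
      x ≤ y ⊔ z ∧ y ≤ z ⊔ x ∧ z ≤ x ⊔ y := by
  refine and_congr Iff.rfl ⟨?_, ?_⟩
  · rintro ⟨s, h1, h2, h3⟩
    rw [isLUB_pair.unique h1, isLUB_pair.unique h2, isLUB_pair.unique h3]
    exact ⟨h1.1 (by simp), h1.1 (by simp), h2.1 (by simp)⟩
  · rintro ⟨h1, h2, h3⟩
    refine ⟨x ⊔ y, isLUB_pair, ?_, ?_⟩
    · rw [show x ⊔ y = y ⊔ z from le_antisymm (sup_le h1 le_sup_left) (sup_le le_sup_right h3)]
      exact isLUB_pair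
    · rw [show x ⊔ y = z ⊔ x from le_antisymm (sup_le le_sup_right h2) (sup_le h3 le_sup_left)]
      exact isLUB_pair

/-- Two irreducibles whose join contains a third element are incomparable to it. -/
lemma collinear_of_le_sup {M : Type u} [Lattice M] {x y z : M} (hz : SupIrred z)
    (hzx : ¬ z ≤ x) (hzy : ¬ z ≤ y)
    (h1 : x ≤ y ⊔ z) (h2 : y ≤ z ⊔ x) (h3 : z ≤ x ⊔ y) : Collinear x y z := by
  have hxz : ¬ x ≤ z := fun h => by
    have : x ⊔ y = z := le_antisymm (sup_le h (h2.trans (sup_le le_rfl h))) h3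
    rcases hz.2 this with h | h
    exacts [hzx h.ge, hzy h.ge]
  have hyz : ¬ y ≤ z := fun h => by
    have : x ⊔ y = z := le_antisymm (sup_le (h1.trans (sup_le h le_rfl)) h) h3
    rcases hz.2 this with h | h
    exacts [hzx h.ge, hzy h.ge]
  refine collinear_iff.2 ⟨⟨⟨fun h => ?_, fun h => ?_⟩, ⟨hyz, hzy⟩, hzx, hxz⟩, h1, h2, h3⟩
  · exact hzy (h3.trans (sup_le h le_rfl))
  · exact hzx (h3.trans (sup_le le_rfl h))

variable {α : Type u} [hα : PartialOrder α]

lemma exists_collinear_of_le_isLUB (hm : IsModularLatticeOrder α) (hw : WellFoundedLT α)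
    {r x y s : α} (hr : IsJoinIrred r) (hs : IsLUB {x, y} s) (hrs : r ≤ s)
    (hrx : ¬ r ≤ x) (hry : ¬ r ≤ y) :
    ∃ p ≤ x, ∃ q ≤ y, IsJoinIrred p ∧ IsJoinIrred q ∧ Collinear p q r := by
  obtain ⟨I, rfl, hI⟩ := hm
  rw [isJoinIrred_iff_supIrred] at hr
  obtain rfl := isLUB_pair.unique hs
  obtain ⟨p, hp, q, hq, hpi, hqi, h1, h2, h3⟩ := exists_supIrred_of_le_sup hr hrs hrx hry
  exact ⟨p, hp, q, hq, isJoinIrred_iff_supIrred.2 hpi, isJoinIrred_iff_supIrred.2 hqi,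
    collinear_of_le_sup hr (fun h => hrx (h.trans hp)) (fun h => hry (h.trans hq)) h2 h3 h1⟩

/-- The weak triangle alternatives for irreducibles of a modular lattice. In the first one, `t`, `s`
and `u` are the joins of the lines through `a, c, p`, through `b, c, q` and through `a, b, x`. -/
lemma triangle_alternatives_of_collinear (hm : IsModularLatticeOrder α) (hw : WellFoundedLT α)
    {a b c p q : α} (ha : IsJoinIrred a) (hb : IsJoinIrred b) (hc : IsJoinIrred c)
    (hp : IsJoinIrred p) (hq : IsJoinIrred q) (h1 : Collinear a c p) (h2 : Collinear b c q) :
    (∃ x t s u, IsJoinIrred x ∧ Collinear a b x ∧ Collinear p q x ∧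
      ((a ≤ t ∧ c ≤ t ∧ p ≤ t) ∧ ¬ b ≤ t ∧ ¬ q ≤ t ∧ ¬ x ≤ t) ∧
      ((b ≤ s ∧ c ≤ s ∧ q ≤ s) ∧ ¬ a ≤ s ∧ ¬ p ≤ s ∧ ¬ x ≤ s) ∧
      ((a ≤ u ∧ b ≤ u ∧ x ≤ u) ∧ ¬ c ≤ u ∧ ¬ p ≤ u ∧ ¬ q ≤ u)) ∨
    (∃ a' ≤ a, IsJoinIrred a' ∧ Collinear b q a') ∨
    Collinear b q p ∨
    (∃ a' ≤ a, ∃ p' ≤ p, IsJoinIrred a' ∧ IsJoinIrred p' ∧ Collinear q a' p') ∨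
    (q ≤ a ∨ q ≤ p) := by
  obtain ⟨I, rfl, hI⟩ := hm
  simp only [isJoinIrred_iff_supIrred] at *
  rw [collinear_iff] at h1 h2
  obtain ⟨⟨hiac, hicp, hipa⟩, hac, hca, hpac⟩ := h1
  obtain ⟨⟨hibc, hicq, hiqb⟩, hbc, hcb, hqbc⟩ := h2
  by_cases hqa : q ≤ a
  · tauto
  by_cases hqp : q ≤ p
  · tauto
  set t := a ⊔ p with ht
  set s := b ⊔ q with hs
  have hct : c ≤ t := hca.trans (sup_comm p a).le
  have hcs : c ≤ s := hcb.trans (sup_comm q b).le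
  have hat : a ≤ t := le_sup_left
  have hpt : p ≤ t := le_sup_right
  have hbs : b ≤ s := le_sup_left
  have hqs : q ≤ s := le_sup_right
  have tac : t ≤ a ⊔ c := sup_le le_sup_left hpac
  have tcp : t ≤ c ⊔ p := sup_le hac le_sup_right
  have tpa : t ≤ p ⊔ a := (sup_comm a p).le
  have sbc : s ≤ b ⊔ c := sup_le le_sup_left hqbc
  have scq : s ≤ c ⊔ q := sup_le hbc le_sup_right
  have sqb : s ≤ q ⊔ b := (sup_comm b q).le
  by_cases hqt : q ≤ t
  · obtain ⟨a', ha', p', hp', hia, hip, k1, k2, k3⟩ := exists_supIrred_of_le_sup hq hqt hqa hqp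
    refine Or.inr (Or.inr (Or.inr (Or.inl ⟨a', ha', p', hp', hia, hip, ?_⟩)))
    have := collinear_of_le_sup hq (fun h => hqa (h.trans ha')) (fun h => hqp (h.trans hp'))
      k2 k3 k1
    rw [collinear_iff] at this ⊢
    tauto
  have hbt : ¬ b ≤ t := fun h => hqt (hqbc.trans (sup_le h hct))
  have key : ∀ z, SupIrred z → ¬ b ≤ z → ¬ q ≤ z → z ≤ s → s ≤ b ⊔ z → s ≤ q ⊔ z →
      Collinear b q z := fun z _ hbz hqz k1 k2 k3 => by
    rw [collinear_iff]
    refine ⟨⟨⟨hiqb.2, hiqb.1⟩, ⟨hqz, fun h => ?_⟩, fun h => ?_, hbz⟩, hbs.trans k3,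
      (hqs.trans k2).trans (sup_comm b z).le, k1⟩
    · exact hiqb.2 (hbs.trans (k3.trans (sup_le le_rfl h)))
    · exact hiqb.1 (hqs.trans (k2.trans (sup_le le_rfl h)))
  by_cases hps : p ≤ s
  · rcases sup_eq_line_of_le_line hc hq hat hpt hca tcp hbs hcs hqs sbc scq sqb hqt hps with
      ⟨k1, k2⟩ | ⟨k1, k2⟩
    · exact Or.inr (Or.inr (Or.inl (key p hp (fun h => hbt (h.trans hpt)) hqp hps k1 k2)))
    · exact Or.inr (Or.inl ⟨a, le_rfl, ha, key a ha (fun h => hbt (h.trans hat)) hqa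
        (hac.trans (sup_le hcs hps)) k1 k2⟩)
  have has : ¬ a ≤ s := fun h => hps (hpac.trans (sup_le h hcs))
  by_cases hcu : c ≤ a ⊔ b
  · obtain ⟨a', ha', hia, k1, k2, k3⟩ := exists_collinear_of_le_sup hb hq hat hct tac hbs hqs
      sbc scq sqb hiqb.2 hiqb.1 hbt hcu
    exact Or.inr (Or.inl ⟨a', ha', hia, key a' hia (fun h => hbt ((h.trans ha').trans hat))
      (fun h => hqa (h.trans ha')) k1 k2 k3⟩)
  obtain ⟨x, hx, hxu, hxv, hbx, hax⟩ := exists_supIrred_off_lines ha hb hp hq hat hct hpt tac tcp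
    tpa hbs hcs hqs sbc scq sqb has hps hbt hqt hcu
  have hts : t ≤ s ⊔ a := tac.trans (sup_le le_sup_right (hcs.trans le_sup_left))
  have hst : s ≤ t ⊔ b := sbc.trans (sup_le le_sup_right (hct.trans le_sup_left))
  have hxt : ¬ x ≤ t := fun h => hbt (hbx.trans (sup_le h le_rfl))
  have hxs : ¬ x ≤ s := fun h => has (hax.trans (sup_le h le_rfl))
  refine Or.inl ⟨x, t, s, a ⊔ b, hx, ?_, ?_, ⟨⟨hat, hct, hpt⟩, hbt, hqt, hxt⟩,
    ⟨⟨hbs, hcs, hqs⟩, has, hps, hxs⟩, ⟨le_sup_left, le_sup_right, hxu⟩, hcu, fun h => ?_,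
    fun h => ?_⟩
  · refine collinear_of_le_sup hx (fun h => hxt (h.trans hat)) (fun h => hxs (h.trans hbs)) ?_ ?_
      hxu
    · rw [sup_comm]
      exact le_sup_of_supIrred_of_le_sup ha hbs (hxu.trans (sup_comm a b).le) has hax
    · exact le_sup_of_supIrred_of_le_sup hb hat hxu hbt hbx
  · refine collinear_of_le_sup hx (fun h => hxt (h.trans hpt)) (fun h => hxs (h.trans hqs)) ?_ ?_
      hxv
    · rw [sup_comm]
      exact le_sup_of_supIrred_of_le_sup hp hqs (hxv.trans (sup_comm p q).le) hps
        (hpt.trans (hts.trans (sup_le le_sup_right hax)))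
    · exact le_sup_of_supIrred_of_le_sup hq hpt hxv hqt
        (hqs.trans (hst.trans (sup_le le_sup_right hbx)))
  · exact hcu (hca.trans (sup_le h le_sup_left))
  · exact hcu (hcb.trans (sup_le h le_sup_right))

end Collinear

/-! ### Posets of finite rank -/

section FiniteRank

variable {α : Type u} [PartialOrder α]

lemma FiniteRank.height_lt_top (h : FiniteRank α) (x : α) : Order.height x < ⊤ :=
  WithBot.coe_lt_coe.1 ((Order.height_le_krullDim x).trans_lt h)

lemma FiniteRank.wellFoundedLT (h : FiniteRank α) : WellFoundedLT α :=
  StrictMono.wellFoundedLT (f := (Order.height : α → ℕ∞))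
    fun x _ hxy => Order.height_strictMono hxy (h.height_lt_top x)

lemma FiniteRank.exists_height_max (h : FiniteRank α) {S : Set α} (hS : S.Nonempty) :
    ∃ m ∈ S, ∀ x ∈ S, Order.height x ≤ Order.height m := by
  obtain ⟨x₀, hx₀⟩ := hS
  have : Nonempty α := ⟨x₀⟩
  obtain ⟨n, hn⟩ : ∃ n : ℕ, ∀ x : α, Order.height x ≤ n := by
    rw [FiniteRank, Order.krullDim_eq_iSup_height_of_nonempty] at h
    have h' : (⨆ a : α, Order.height a) < ⊤ := WithBot.coe_lt_coe.1 h
    obtain ⟨n, hn⟩ := ENat.ne_top_iff_exists.1 h'.ne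
    exact ⟨n, fun x => hn ▸ le_iSup (fun a : α => Order.height a) x⟩
  have hf := fun x : α => ENat.natCast_toNat (ne_top_of_le_ne_top (ENat.natCast_ne_top n) (hn x))
  have hb : BddAbove ((fun x : α => (Order.height x).toNat) '' S) := ⟨n, by
    rintro _ ⟨x, -, rfl⟩
    exact ENat.toNat_le_of_le_natCast (hn x)⟩
  obtain ⟨m, hm, hmax⟩ := Nat.sSup_mem (Set.Nonempty.image _ ⟨x₀, hx₀⟩) hb
  refine ⟨m, hm, fun x hx => ?_⟩
  rw [← hf x, ← hf m, Nat.cast_le]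
  exact (le_csSup hb ⟨x, hx, rfl⟩).trans hmax.ge

lemma FiniteRank.irr {L : Type u} [PartialOrder L] (h : FiniteRank L) : FiniteRank (Irr L) :=
  (Order.krullDim_le_of_strictMono (Subtype.val : Irr L → L) fun _ _ hxy => hxy).trans_lt h

end FiniteRank

/-! ### Triangle configurations from three lines -/

section Configuration

variable {P : Type u} [PartialOrder P] {C : P → P → P → Prop}

lemma IsCollinearityRel.ne (hC : IsCollinearityRel C) {u v w : P} (h : C u v w) :
    u ≠ v ∧ v ≠ w ∧ w ≠ u := by
  obtain ⟨h1, h2, h3⟩ := hC.ct1 u v w h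
  exact ⟨fun h => h1.1 h.le, fun h => h2.1 h.le, fun h => h3.1 h.le⟩

lemma triple_eq_of_mem {α : Type u} {a b c u v w : α} (hu : u ∈ ({a, b, c} : Set α))
    (hv : v ∈ ({a, b, c} : Set α)) (hw : w ∈ ({a, b, c} : Set α)) (h1 : u ≠ v) (h2 : v ≠ w)
    (h3 : w ≠ u) : ({u, v, w} : Set α) = {a, b, c} := by
  ext z
  simp only [Set.mem_insert_iff, Set.mem_singleton_iff] at *
  grind

/-- A collinear triple with two members in a subspace `T` lies in `T`. -/
lemma triple_eq_of_subspace (hC : IsCollinearityRel C) {T : Set P} (hT : IsSubspace C T)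
    {l : List P} {a b c u v w : P} (hl : ∀ y ∈ l, y ∈ T → y ∈ ({a, b, c} : Set P))
    (hu : u ∈ l) (hv : v ∈ l) (hw : w ∈ l) (h : C u v w) (huT : u ∈ T) (hvT : v ∈ T) :
    ({u, v, w} : Set P) = {a, b, c} := by
  obtain ⟨h1, h2, h3⟩ := hC.ne h
  exact triple_eq_of_mem (hl u hu huT) (hl v hv hvT) (hl w hw (hT.2 u huT v hvT w h)) h1 h2 h3

lemma triangleConfiguration_of_subspaces (hC : IsCollinearityRel C) {T S U : Set P}
    (hT : IsSubspace C T) (hS : IsSubspace C S) (hU : IsSubspace C U) {a b c p q x : P}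
    (h1 : C a c p) (h2 : C b c q) (h3 : C a b x) (h4 : C p q x)
    (haT : a ∈ T) (hcT : c ∈ T) (hpT : p ∈ T) (hbT : b ∉ T) (hqT : q ∉ T) (hxT : x ∉ T)
    (hbS : b ∈ S) (hcS : c ∈ S) (hqS : q ∈ S) (haS : a ∉ S) (hpS : p ∉ S) (hxS : x ∉ S)
    (haU : a ∈ U) (hbU : b ∈ U) (hxU : x ∈ U) (hcU : c ∉ U) (hpU : p ∉ U) (hqU : q ∉ U) :
    TriangleConfiguration C a b c p q x := by
  have hsymm : ∀ {y z : P}, Incomp y z → Incomp z y := fun h => ⟨h.2, h.1⟩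
  have hinc : ∀ {A B : Set P}, IsSubspace C A → IsSubspace C B → ∀ {y z : P}, y ∈ A → z ∉ A →
      z ∈ B → y ∉ B → Incomp y z := fun hA hB _ _ hyA hzA hzB hyB =>
    ⟨fun h => hyB (hB.1 h hzB), fun h => hzA (hA.1 h hyA)⟩
  refine ⟨h3, h4, ?_, ?_⟩
  · obtain ⟨i1, i2, i3⟩ := hC.ct1 _ _ _ h1
    obtain ⟨j1, j2, j3⟩ := hC.ct1 _ _ _ h2
    obtain ⟨k1, k2, k3⟩ := hC.ct1 _ _ _ h3
    obtain ⟨l1, l2, l3⟩ := hC.ct1 _ _ _ h4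
    have m1 : Incomp a q := hinc hT hS haT hqT hqS haS
    have m2 : Incomp b p := hinc hS hT hbS hpS hpT hbT
    have m3 : Incomp c x := hinc hT hU hcT hxT hxU hcU
    simp [k1, i1, hsymm i3, m1, hsymm k3, j1, m2, hsymm j3, k2, i2, j2, m3, l1, hsymm l3, l2]
  · intro u hu v hv w hw h
    have lT : ∀ y ∈ [a, b, c, p, q, x], y ∈ T → y ∈ ({a, c, p} : Set P) := by
      simp [hbT, hqT, hxT]
    have lS : ∀ y ∈ [a, b, c, p, q, x], y ∈ S → y ∈ ({b, c, q} : Set P) := by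
      simp [haS, hpS, hxS]
    have lU : ∀ y ∈ [a, b, c, p, q, x], y ∈ U → y ∈ ({a, b, x} : Set P) := by
      simp [hcU, hpU, hqU]
    have h' := hC.rotate _ _ _ h
    have h'' := hC.rotate _ _ _ h'
    have r1 : ({v, w, u} : Set P) = {u, v, w} := by ext; simp; tauto
    have r2 : ({w, u, v} : Set P) = {u, v, w} := by ext; simp; tauto
    by_contra hno
    push Not at hno
    obtain ⟨n1, n2, n3, n4⟩ := hno
    have t1 : ¬ (u ∈ T ∧ v ∈ T) := fun k =>
      n1 (triple_eq_of_subspace hC hT lT hu hv hw h k.1 k.2)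
    have t2 : ¬ (v ∈ T ∧ w ∈ T) := fun k =>
      n1 (r1 ▸ triple_eq_of_subspace hC hT lT hv hw hu h' k.1 k.2)
    have t3 : ¬ (w ∈ T ∧ u ∈ T) := fun k =>
      n1 (r2 ▸ triple_eq_of_subspace hC hT lT hw hu hv h'' k.1 k.2)
    have s1 : ¬ (u ∈ S ∧ v ∈ S) := fun k =>
      n2 (triple_eq_of_subspace hC hS lS hu hv hw h k.1 k.2)
    have s2 : ¬ (v ∈ S ∧ w ∈ S) := fun k =>
      n2 (r1 ▸ triple_eq_of_subspace hC hS lS hv hw hu h' k.1 k.2)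
    have s3 : ¬ (w ∈ S ∧ u ∈ S) := fun k =>
      n2 (r2 ▸ triple_eq_of_subspace hC hS lS hw hu hv h'' k.1 k.2)
    have u1 : ¬ (u ∈ U ∧ v ∈ U) := fun k =>
      n3 (triple_eq_of_subspace hC hU lU hu hv hw h k.1 k.2)
    have u2 : ¬ (v ∈ U ∧ w ∈ U) := fun k =>
      n3 (r1 ▸ triple_eq_of_subspace hC hU lU hv hw hu h' k.1 k.2)
    have u3 : ¬ (w ∈ U ∧ u ∈ U) := fun k =>
      n3 (r2 ▸ triple_eq_of_subspace hC hU lU hw hu hv h'' k.1 k.2)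
    obtain ⟨d1, d2, d3⟩ := hC.ne h
    -- Each of `a, b, c` lies on two of the three lines; only one other point avoids both.
    have cl : ∀ y z z', y ∈ [a, b, c, p, q, x] → z ∈ [a, b, c, p, q, x] →
        z' ∈ [a, b, c, p, q, x] → z ≠ z' → ¬ (y ∈ T ∧ z ∈ T) → ¬ (y ∈ T ∧ z' ∈ T) →
        ¬ (y ∈ S ∧ z ∈ S) → ¬ (y ∈ S ∧ z' ∈ S) → ¬ (y ∈ U ∧ z ∈ U) → ¬ (y ∈ U ∧ z' ∈ U) →
        y ∈ ({p, q, x} : Set P) := by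
      intro y z z' hy hz hz'
      simp only [List.mem_cons, List.not_mem_nil, or_false] at hy hz hz'
      simp only [Set.mem_insert_iff, Set.mem_singleton_iff]
      clear * - hy hz hz' haT hcT hpT hbT hqT hxT hbS hcS hqS haS hpS hxS haU hbU hxU hcU hpU hqU
      rcases hy with rfl | rfl | rfl | rfl | rfl | rfl
      case inr.inr.inr.inl => simp
      case inr.inr.inr.inr.inl => simp
      case inr.inr.inr.inr.inr => simp
      all_goals
        rcases hz with rfl | rfl | rfl | rfl | rfl | rfl <;>
        rcases hz' with rfl | rfl | rfl | rfl | rfl | rfl <;> simp_all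
    exact n4 (triple_eq_of_mem
      (cl u v w hu hv hw d2 t1 (fun k => t3 k.symm) s1 (fun k => s3 k.symm) u1
        (fun k => u3 k.symm))
      (cl v w u hv hw hu d3 t2 (fun k => t1 k.symm) s2 (fun k => s1 k.symm) u2
        (fun k => u1 k.symm))
      (cl w u v hw hu hv d1 t3 (fun k => t2 k.symm) s3 (fun k => s2 k.symm) u3
        (fun k => u2 k.symm)) d1 d2 d3)

end Configuration

/-! ### The PPIP of a modular semilattice -/

section Semilattice

variable {L : Type u} [PartialOrder L]

lemma IsModularLatticeOrder.exists_isLUB {α : Type u} [h : PartialOrder α]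
    (hm : IsModularLatticeOrder α) (x y : α) : ∃ s, IsLUB {x, y} s := by
  obtain ⟨I, rfl, -⟩ := hm
  exact ⟨x ⊔ y, isLUB_pair⟩

lemma isLUB_pair_iff {x y s : L} :
    IsLUB {x, y} s ↔ x ≤ s ∧ y ≤ s ∧ ∀ u, x ≤ u → y ≤ u → s ≤ u := by
  simp [IsLUB, IsLeast, upperBounds, lowerBounds, and_assoc]

lemma exists_isLUB_comm {x y : L} : (∃ s, IsLUB {x, y} s) ↔ ∃ s, IsLUB {y, x} s := by
  rw [Set.pair_comm]

/-- Induction over a well-founded poset along binary joins, starting from the least element and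
the join-irreducible elements. -/
lemma irr_induction (hwf : WellFoundedLT L) {motive : L → Prop}
    (bot : ∀ l, IsBot l → motive l) (irr : ∀ l, IsJoinIrred l → motive l)
    (sup : ∀ l a b, IsLUB {a, b} l → a < l → b < l → motive a → motive b → motive l) (l : L) :
    motive l := by
  induction l using WellFoundedLT.induction with
  | ind l ih =>
    by_cases hl : IsBot l
    · exact bot l hl
    by_cases hi : IsJoinIrred l
    · exact irr l hi
    obtain ⟨a, b, hab, hla, hlb⟩ : ∃ a b, IsLUB {a, b} l ∧ l ≠ a ∧ l ≠ b := by
      by_contra hno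
      push Not at hno
      exact hi ⟨hl, fun a b hab => or_iff_not_imp_left.2 (hno a b hab)⟩
    have h := isLUB_pair_iff.1 hab
    have ha : a < l := lt_of_le_of_ne h.1 hla.symm
    have hb : b < l := lt_of_le_of_ne h.2.1 hlb.symm
    exact sup l a b hab ha hb (ih a ha) (ih b hb)

/-- Every element is the join of the join-irreducible elements below it. -/
lemma le_of_forall_irr_le (hwf : WellFoundedLT L) (l : L) :
    ∀ {u : L}, (∀ p : Irr L, p.1 ≤ l → p.1 ≤ u) → l ≤ u := by
  induction l using irr_induction hwf with
  | bot l hl => exact fun _ => hl _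
  | irr l hl => exact fun h => h ⟨l, hl⟩ le_rfl
  | sup l a b hab ha hb iha ihb =>
    exact fun h => (isLUB_pair_iff.1 hab).2.2 _ (iha fun p hp => h p (hp.trans ha.le))
      (ihb fun p hp => h p (hp.trans hb.le))

namespace IsModularSemilattice

/-- Joins in a principal ideal are joins in the semilattice, because an upper bound `u` may be
replaced by its meet with `w`. -/
lemma isLUB_pair_coe (hL : IsModularSemilattice L) {w : L} {x y s : Set.Iic w} :
    IsLUB {x, y} s ↔ IsLUB {x.1, y.1} s.1 := by
  rw [isLUB_pair_iff, isLUB_pair_iff]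
  refine ⟨fun ⟨h1, h2, h3⟩ => ⟨h1, h2, fun u hx hy => ?_⟩,
    fun ⟨h1, h2, h3⟩ => ⟨h1, h2, fun u hx hy => h3 u hx hy⟩⟩
  obtain ⟨m, hm⟩ := hL.exists_inf u w
  have hmu : m ≤ u := hm.1 (by simp)
  have hmw : m ≤ w := hm.1 (by simp)
  have key : ∀ z : L, z ≤ u → z ≤ w → z ≤ m := fun z h h' => hm.2 (by simp [lowerBounds, h, h'])
  exact le_trans (show s.1 ≤ m from h3 ⟨m, hmw⟩ (key _ hx x.2) (key _ hy y.2)) hmu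

lemma isJoinIrred_coe (hL : IsModularSemilattice L) {w : L} {x : Set.Iic w} :
    IsJoinIrred x ↔ IsJoinIrred x.1 := by
  refine and_congr (not_congr ⟨fun h y => ?_, fun h y => h y.1⟩)
    ⟨fun h a b hab => ?_, fun h a b hab => ?_⟩
  · obtain ⟨m, hm⟩ := hL.exists_inf y w
    have hmw : m ≤ w := hm.1 (by simp)
    have hmy : m ≤ y := hm.1 (by simp)
    exact le_trans (show x.1 ≤ m from h ⟨m, hmw⟩) hmy
  · have ha : a ≤ x.1 := hab.1 (by simp)
    have hb : b ≤ x.1 := hab.1 (by simp)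
    have := h ⟨a, ha.trans x.2⟩ ⟨b, hb.trans x.2⟩ (hL.isLUB_pair_coe.2 hab)
    simpa [Subtype.ext_iff] using this
  · have := h a.1 b.1 (hL.isLUB_pair_coe.1 hab)
    simpa [Subtype.ext_iff] using this

lemma collinear_coe (hL : IsModularSemilattice L) {w : L} {x y z : Set.Iic w} :
    Collinear x y z ↔ Collinear x.1 y.1 z.1 := by
  refine and_congr Iff.rfl ⟨fun ⟨s, h1, h2, h3⟩ => ⟨s.1, hL.isLUB_pair_coe.1 h1,
    hL.isLUB_pair_coe.1 h2, hL.isLUB_pair_coe.1 h3⟩, fun ⟨s, h1, h2, h3⟩ => ?_⟩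
  have hs : s ≤ w := h1.2 (by simp [upperBounds]; exact ⟨x.2, y.2⟩)
  exact ⟨⟨s, hs⟩, hL.isLUB_pair_coe.2 h1, hL.isLUB_pair_coe.2 h2, hL.isLUB_pair_coe.2 h3⟩

lemma exists_isLUB_of_le (hL : IsModularSemilattice L) {x y w : L} (hx : x ≤ w)
    (hy : y ≤ w) : ∃ s, IsLUB {x, y} s := by
  obtain ⟨s, hs⟩ := (hL.principal_modular w).exists_isLUB ⟨x, hx⟩ ⟨y, hy⟩
  exact ⟨s.1, hL.isLUB_pair_coe.1 hs⟩

lemma isInconsistencyRel (hL : IsModularSemilattice L) : IsInconsistencyRel (irrInc (L := L)) where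
  symm p q h := fun hs => h (exists_isLUB_comm.1 hs)
  ic1 p q h := fun ⟨w, h1, h2⟩ => h (hL.exists_isLUB_of_le h1 h2)
  ic2 p q p' q' h h1 h2 := fun ⟨s, hs⟩ => by
    rw [isLUB_pair_iff] at hs
    exact h (hL.exists_isLUB_of_le (le_trans (show p.1 ≤ p'.1 from h1) hs.1)
      (le_trans (show q.1 ≤ q'.1 from h2) hs.2.1))

lemma isCollinearityRel : IsCollinearityRel (irrColl (L := L)) where
  swap p q r := fun ⟨⟨h1, h2, h3⟩, s, k1, k2, k3⟩ =>
    ⟨⟨⟨h1.2, h1.1⟩, ⟨h3.2, h3.1⟩, ⟨h2.2, h2.1⟩⟩, s, by rwa [Set.pair_comm],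
      by rwa [Set.pair_comm], by rwa [Set.pair_comm]⟩
  rotate p q r := fun ⟨⟨h1, h2, h3⟩, s, k1, k2, k3⟩ => ⟨⟨h2, h3, h1⟩, s, k2, k3, k1⟩
  ct1 p q r h := h.1
  ct2 p q r w := fun ⟨_, s, k1, k2, _⟩ hp hq => by
    rw [isLUB_pair_iff] at k1 k2
    exact k2.2.1.trans (k1.2.2 w.1 hp hq)

/-- The join-irreducible elements below a join lie below one of the summands or on a line that
connects them. -/
lemma irr_le_of_isLUB (hL : IsModularSemilattice L) (hwf : WellFoundedLT L) {l m s : L}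
    (hs : IsLUB {l, m} s) {r : Irr L} (hr : r.1 ≤ s) :
    r.1 ≤ l ∨ r.1 ≤ m ∨ ∃ p q : Irr L, p.1 ≤ l ∧ q.1 ≤ m ∧ irrColl p q r := by
  by_cases hl : r.1 ≤ l
  · exact Or.inl hl
  by_cases hm : r.1 ≤ m
  · exact Or.inr (Or.inl hm)
  have h := isLUB_pair_iff.1 hs
  have hwf' : WellFoundedLT (Set.Iic s) := inferInstance
  obtain ⟨p', hp', q', hq', hpi, hqi, hC⟩ := exists_collinear_of_le_isLUB
    (hL.principal_modular s) hwf' (r := ⟨r.1, hr⟩) (x := ⟨l, h.1⟩) (y := ⟨m, h.2.1⟩)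
    (s := ⟨s, le_rfl⟩) (hL.isJoinIrred_coe.2 r.2) (hL.isLUB_pair_coe.2 hs) hr hl hm
  exact Or.inr (Or.inr ⟨⟨p'.1, hL.isJoinIrred_coe.1 hpi⟩, ⟨q'.1, hL.isJoinIrred_coe.1 hqi⟩, hp',
    hq', hL.collinear_coe.1 hC⟩)

lemma regularity (hL : IsModularSemilattice L) (hwf : WellFoundedLT L) :
    Regularity (irrColl (L := L)) := by
  rintro p q r r' ⟨-, s, k1, k2, -⟩ hr hp hq
  have hrs : r'.1 ≤ s := le_trans (show r'.1 ≤ r.1 from hr) (isLUB_pair_iff.1 k2).2.1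
  rcases hL.irr_le_of_isLUB hwf k1 hrs with h | h | ⟨p', q', h⟩
  exacts [absurd h hp, absurd h hq, ⟨p', q', h⟩]

lemma isSubspace_le (t : L) : IsSubspace (irrColl (L := L)) {y | y.1 ≤ t} := by
  refine ⟨fun x y hyx hx => le_trans (show y.1 ≤ x.1 from hyx) hx, ?_⟩
  rintro p hp q hq r ⟨-, s, k1, k2, -⟩
  rw [isLUB_pair_iff] at k1 k2
  exact k2.2.1.trans (k1.2.2 t hp hq)

lemma weakTriangle (hL : IsModularSemilattice L) (hwf : WellFoundedLT L) :
    WeakTriangle (irrInc (L := L)) (irrColl (L := L)) := by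
  intro a b c p q h1 h2 hcons
  have hjoin : ∀ x ∈ ({a, b, c, p, q} : Set (Irr L)), ∀ y ∈ ({a, b, c, p, q} : Set (Irr L)),
      ∃ s, IsLUB {x.1, y.1} s := fun x hx y hy => not_not.1 (hcons x hx y hy)
  obtain ⟨w, hw⟩ := hL.exists_sup₃ a.1 b.1 c.1 (hjoin a (by simp) b (by simp))
    (hjoin b (by simp) c (by simp)) (hjoin c (by simp) a (by simp))
  have ha : a.1 ≤ w := hw.1 (by simp)
  have hb : b.1 ≤ w := hw.1 (by simp)
  have hc : c.1 ≤ w := hw.1 (by simp)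
  have hp : p.1 ≤ w := (isSubspace_le w).2 a ha c hc p h1
  have hq : q.1 ≤ w := (isSubspace_le w).2 b hb c hc q h2
  have hwf' : WellFoundedLT (Set.Iic w) := inferInstance
  rcases triangle_alternatives_of_collinear (hL.principal_modular w) hwf' (a := ⟨a.1, ha⟩)
    (b := ⟨b.1, hb⟩) (c := ⟨c.1, hc⟩) (p := ⟨p.1, hp⟩) (q := ⟨q.1, hq⟩)
    (hL.isJoinIrred_coe.2 a.2) (hL.isJoinIrred_coe.2 b.2) (hL.isJoinIrred_coe.2 c.2)
    (hL.isJoinIrred_coe.2 p.2) (hL.isJoinIrred_coe.2 q.2) (hL.collinear_coe.2 h1)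
    (hL.collinear_coe.2 h2) with
    ⟨x, t, s, u, hx, k1, k2, ⟨⟨t1, t2, t3⟩, t4, t5, t6⟩, ⟨⟨s1, s2, s3⟩, s4, s5, s6⟩,
      ⟨u1, u2, u3⟩, u4, u5, u6⟩ | ⟨a', ha', hi, k⟩ | k | ⟨a', ha', p', hp', hia, hip, k⟩ | k
  · exact Or.inl ⟨⟨x.1, hL.isJoinIrred_coe.1 hx⟩, triangleConfiguration_of_subspaces
      isCollinearityRel (isSubspace_le t.1) (isSubspace_le s.1) (isSubspace_le u.1) h1 h2
      (hL.collinear_coe.1 k1) (hL.collinear_coe.1 k2) t1 t2 t3 t4 t5 t6 s1 s2 s3 s4 s5 s6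
      u1 u2 u3 u4 u5 u6⟩
  · exact Or.inr (Or.inl ⟨⟨a'.1, hL.isJoinIrred_coe.1 hi⟩, ha', hL.collinear_coe.1 k⟩)
  · exact Or.inr (Or.inr (Or.inl (hL.collinear_coe.1 k)))
  · exact Or.inr (Or.inr (Or.inr (Or.inl ⟨⟨a'.1, hL.isJoinIrred_coe.1 hia⟩,
      ⟨p'.1, hL.isJoinIrred_coe.1 hip⟩, ha', hp', hL.collinear_coe.1 k⟩)))
  · exact Or.inr (Or.inr (Or.inr (Or.inr k)))

lemma consistent_of_collinear (hL : IsModularSemilattice L) {p q r : Irr L}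
    (h : irrColl p q r) : Consistent (irrInc (L := L)) {p, q, r} := by
  obtain ⟨-, s, k1, k2, -⟩ := h
  rw [isLUB_pair_iff] at k1 k2
  have hle : ∀ x ∈ ({p, q, r} : Set (Irr L)), x.1 ≤ s := by
    rintro x (rfl | rfl | rfl)
    exacts [k1.1, k1.2.1, k2.2.1]
  exact fun x hx y hy hxy => hxy (hL.exists_isLUB_of_le (hle x hx) (hle y hy))

lemma not_irrInc_of_collinear (hL : IsModularSemilattice L) {p q r x : Irr L}
    (h : irrColl p q r) (hp : ¬ irrInc x p) (hq : ¬ irrInc x q) : ¬ irrInc x r := by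
  rw [irrInc, not_not] at *
  obtain ⟨w, hw⟩ := hL.exists_sup₃ x.1 p.1 q.1 hp ⟨_, h.2.choose_spec.1⟩ (exists_isLUB_comm.1 hq)
  have hr : r.1 ≤ w := (isSubspace_le w).2 p (hw.1 (by simp)) q (hw.1 (by simp)) r h
  exact hL.exists_isLUB_of_le (hw.1 (by simp)) hr

lemma isPPIP (hL : IsModularSemilattice L) (hwf : WellFoundedLT L) :
    IsPPIP (irrInc (L := L)) (irrColl (L := L)) where
  inconsistency := hL.isInconsistencyRel
  collinearity := isCollinearityRel
  regularity := hL.regularity hwf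
  weakTriangle := hL.weakTriangle hwf
  cc1 _ _ _ h := hL.consistent_of_collinear h
  cc2 p q r h x := by
    have h' := isCollinearityRel.rotate _ _ _ h
    have h'' := isCollinearityRel.rotate _ _ _ h'
    have k1 : ¬ irrInc x p → ¬ irrInc x q → ¬ irrInc x r := hL.not_irrInc_of_collinear h
    have k2 : ¬ irrInc x q → ¬ irrInc x r → ¬ irrInc x p := hL.not_irrInc_of_collinear h'
    have k3 : ¬ irrInc x r → ¬ irrInc x p → ¬ irrInc x q := hL.not_irrInc_of_collinear h''
    simp only [Set.Subsingleton, Set.mem_insert_iff, Set.mem_singleton_iff, Set.mem_ofPred_eq,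
      forall_eq_or_imp, forall_eq]
    by_contra hno
    push Not at hno
    obtain ⟨h1, y, ⟨hy, hxy⟩, z, ⟨hz, hxz⟩, hyz⟩ := hno
    rcases hy with rfl | rfl | rfl <;> rcases hz with rfl | rfl | rfl <;> tauto

/-! ### The semilattice as the consistent subspaces of its PPIP -/

lemma exists_bot (hL : IsModularSemilattice L) (hwf : WellFoundedLT L) : ∃ o : L, IsBot o := by
  obtain ⟨x₀⟩ := hL.nonempty
  obtain ⟨o, -, ho⟩ := WellFounded.has_min (wellFounded_lt (α := L)) Set.univ ⟨x₀, trivial⟩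
  refine ⟨o, fun y => ?_⟩
  obtain ⟨m, hm⟩ := hL.exists_inf o y
  have hmo : m ≤ o := hm.1 (by simp)
  have hmy : m ≤ y := hm.1 (by simp)
  rcases hmo.lt_or_eq with h | rfl
  exacts [absurd h (ho m trivial), hmy]

lemma exists_isLUB_of_irr_left (hL : IsModularSemilattice L) (hwf : WellFoundedLT L) (l : L)
    {z : L} : (∀ p : Irr L, p.1 ≤ l → ∃ s, IsLUB {p.1, z} s) → ∃ s, IsLUB {l, z} s := by
  induction l using irr_induction hwf with
  | bot l hl => exact fun _ => hL.exists_isLUB_of_le (hl z) le_rfl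
  | irr l hl => exact fun h => h ⟨l, hl⟩ le_rfl
  | sup l a b hab ha hb iha ihb =>
    intro h
    obtain ⟨w, hw⟩ := hL.exists_sup₃ a b z ⟨l, hab⟩ (ihb fun p hp => h p (hp.trans hb.le))
      (exists_isLUB_comm.1 (iha fun p hp => h p (hp.trans ha.le)))
    have haw : a ≤ w := hw.1 (by simp)
    have hbw : b ≤ w := hw.1 (by simp)
    have hzw : z ≤ w := hw.1 (by simp)
    exact hL.exists_isLUB_of_le ((isLUB_pair_iff.1 hab).2.2 w haw hbw) hzw

/-- The existence of joins can be tested on join-irreducible elements. -/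
lemma exists_isLUB_of_irr (hL : IsModularSemilattice L) (hwf : WellFoundedLT L) {l m : L}
    (h : ∀ p : Irr L, p.1 ≤ l → ∀ q : Irr L, q.1 ≤ m → ∃ s, IsLUB {p.1, q.1} s) :
    ∃ s, IsLUB {l, m} s :=
  hL.exists_isLUB_of_irr_left hwf l fun p hp => exists_isLUB_comm.1
    (hL.exists_isLUB_of_irr_left hwf m fun q hq => exists_isLUB_comm.1 (h p hp q hq))

/-- The elements all of whose irreducibles lie in a consistent subspace `I` form a directed set. By
finite rank it has a greatest element, and this is the element that represents `I`. -/
lemma exists_eq_irr_le (hL : IsModularSemilattice L) (hfin : FiniteRank L) {I : Set (Irr L)}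
    (hI : IsSubspace irrColl I) (hcons : Consistent irrInc I) : ∃ m : L, {p | p.1 ≤ m} = I := by
  have hwf := hfin.wellFoundedLT
  obtain ⟨o, ho⟩ := hL.exists_bot hwf
  obtain ⟨m, hm, hmax⟩ := hfin.exists_height_max (S := {l : L | ∀ p : Irr L, p.1 ≤ l → p ∈ I})
    ⟨o, fun p hp => absurd (fun y => hp.trans (ho y)) p.2.1⟩
  refine ⟨m, Set.Subset.antisymm (fun p hp => hm p hp) fun p hp => ?_⟩
  have hpI : ∀ p' : Irr L, p'.1 ≤ p.1 → p' ∈ I := fun p' hp' => hI.1 hp' hp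
  obtain ⟨s, hs⟩ := hL.exists_isLUB_of_irr hwf (l := p.1) (m := m) fun p' hp' q hq =>
    not_not.1 (hcons p' (hpI p' hp') q (hm q hq))
  have h := isLUB_pair_iff.1 hs
  have hsI : ∀ r : Irr L, r.1 ≤ s → r ∈ I := fun r hr => by
    rcases hL.irr_le_of_isLUB hwf hs hr with h | h | ⟨p', q, hp', hq, hC⟩
    exacts [hpI r h, hm r h, hI.2 p' (hpI p' hp') q (hm q hq) r hC]
  rcases h.2.1.lt_or_eq with hlt | heq
  · exact absurd (Order.height_strictMono hlt (hfin.height_lt_top m)) (hmax s hsI).not_gt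
  · exact heq ▸ h.1

theorem exists_orderIso_csub (hL : IsModularSemilattice L) (hfin : FiniteRank L) :
    ∃ φ : L ≃o Csub (irrInc (L := L)) (irrColl (L := L)),
      (∀ l : L, (φ l).1 = {p : Irr L | p.1 ≤ l}) ∧
      (∀ I, IsLUB (Subtype.val '' I.1 : Set L) (φ.symm I)) ∧
      (∀ I, I.1 = ∅ → IsBot (φ.symm I)) := by
  have hwf := hfin.wellFoundedLT
  let f : L ↪o Csub (irrInc (L := L)) (irrColl (L := L)) := OrderEmbedding.ofMapLEIff
    (fun l => ⟨{p | p.1 ≤ l}, isSubspace_le l, fun x hx y hy hxy =>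
      hxy (hL.exists_isLUB_of_le hx hy)⟩)
    fun l m => ⟨fun h => le_of_forall_irr_le hwf l fun p hp => h hp,
      fun h p hp => le_trans hp h⟩
  let φ := RelIso.ofSurjective f fun I => by
    obtain ⟨m, hm⟩ := hL.exists_eq_irr_le hfin I.2.1 I.2.2
    exact ⟨m, Subtype.ext hm⟩
  have hφ : ∀ l : L, (φ l).1 = {p : Irr L | p.1 ≤ l} := fun l => rfl
  have hlub : ∀ I, IsLUB (Subtype.val '' I.1 : Set L) (φ.symm I) := fun I => by
    have hI : I.1 = {p : Irr L | p.1 ≤ φ.symm I} := by rw [← hφ, φ.apply_symm_apply]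
    rw [hI]
    refine ⟨?_, fun u hu => le_of_forall_irr_le hwf _ fun p hp => hu ⟨p, hp, rfl⟩⟩
    rintro _ ⟨p, hp, rfl⟩
    exact hp
  refine ⟨φ, hφ, hlub, fun I hI => ?_⟩
  have := hlub I
  rwa [hI, Set.image_empty, isLUB_empty_iff] at this

end IsModularSemilattice

end Semilattice

/-! ### Subspaces, their spans and their joins -/

section Sets

variable {P : Type u} {inc : P → P → Prop} {C : P → P → P → Prop}

lemma Consistent.mono {X Y : Set P} (hY : Consistent inc Y) (h : X ⊆ Y) : Consistent inc X :=
  fun x hx y hy => hY x (h hx) y (h hy)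

/-- The union of two sets and of all lines that connect them. -/
def joinSet (C : P → P → P → Prop) (Y Z : Set P) : Set P :=
  Y ∪ Z ∪ {r | ∃ p ∈ Y, ∃ q ∈ Z, C p q r}

lemma subset_joinSet_left (Y Z : Set P) : Y ⊆ joinSet C Y Z := fun _ h => Or.inl (Or.inl h)

lemma subset_joinSet_right (Y Z : Set P) : Z ⊆ joinSet C Y Z := fun _ h => Or.inl (Or.inr h)

lemma mem_joinSet_of_collinear {Y Z : Set P} {p q r : P} (hp : p ∈ Y) (hq : q ∈ Z)
    (h : C p q r) : r ∈ joinSet C Y Z := Or.inr ⟨p, hp, q, hq, h⟩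

end Sets

section Subspaces

variable {P : Type u} [PartialOrder P] {inc : P → P → Prop} {C : P → P → P → Prop}

lemma IsCollinearityRel.rotate' (hC : IsCollinearityRel C) {p q r : P} (h : C p q r) : C r p q :=
  hC.rotate _ _ _ (hC.rotate _ _ _ h)

lemma IsCollinearityRel.swap_right (hC : IsCollinearityRel C) {p q r : P} (h : C p q r) :
    C p r q :=
  hC.rotate _ _ _ (hC.swap _ _ _ h)

lemma IsCollinearityRel.isSubspace_Iic (hC : IsCollinearityRel C) (p : P) :
    IsSubspace C (Set.Iic p) :=
  ⟨isLowerSet_Iic p, fun a ha b hb r h => hC.ct2 a b r p h ha hb⟩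

lemma isSubspace_inter {Y Z : Set P} (hY : IsSubspace C Y) (hZ : IsSubspace C Z) :
    IsSubspace C (Y ∩ Z) :=
  ⟨hY.1.inter hZ.1, fun p hp q hq r h => ⟨hY.2 p hp.1 q hq.1 r h, hZ.2 p hp.2 q hq.2 r h⟩⟩

lemma isSubspace_empty : IsSubspace C (∅ : Set P) :=
  ⟨isLowerSet_empty, fun _ hp => hp.elim⟩

/-- The subspace spanned by a set. -/
def subspaceSpan (C : P → P → P → Prop) (A : Set P) : Set P :=
  ⋂₀ {X | IsSubspace C X ∧ A ⊆ X}

lemma isSubspace_span (A : Set P) : IsSubspace C (subspaceSpan C A) :=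
  ⟨fun _ _ hyx hx X hX => hX.1.1 hyx (hx X hX),
    fun p hp q hq r h X hX => hX.1.2 p (hp X hX) q (hq X hX) r h⟩

lemma subset_span (A : Set P) : A ⊆ subspaceSpan C A := fun _ hx _ hX => hX.2 hx

lemma span_subset {A X : Set P} (hX : IsSubspace C X) (h : A ⊆ X) : subspaceSpan C A ⊆ X :=
  fun _ hx => hx X ⟨hX, h⟩

/-- By consistent-collinearity, the elements consistent with `x` form a subspace. -/
lemma IsPPIP.isSubspace_not_inc (hP : IsPPIP inc C) (x : P) : IsSubspace C {y | ¬ inc x y} := by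
  refine ⟨fun y z hzy hy h => hy (hP.inconsistency.ic2 x z x y h le_rfl hzy),
    fun p hp q hq r h => ?_⟩
  rcases hP.cc2 p q r h x with h' | h'
  · exact h' r (by simp)
  · exact absurd (h' ⟨by simp, hp⟩ ⟨by simp, hq⟩) (hP.collinearity.ne h).1

lemma IsPPIP.consistent_span (hP : IsPPIP inc C) {A : Set P} (hA : Consistent inc A) :
    Consistent inc (subspaceSpan C A) := by
  have h : ∀ x ∈ A, ∀ y ∈ subspaceSpan C A, ¬ inc x y := fun x hx =>
    span_subset (hP.isSubspace_not_inc x) (hA x hx)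
  intro y hy
  exact span_subset (hP.isSubspace_not_inc y) fun x hx hyx =>
    h x hx y hy (hP.inconsistency.symm _ _ hyx)

lemma IsPPIP.consistent_Iic (hP : IsPPIP inc C) (p : P) : Consistent inc (Set.Iic p) :=
  fun x hx y hy h => hP.inconsistency.ic1 x y h ⟨p, hx, hy⟩

/-! ### Joins inside a consistent subspace -/

lemma joinSet_subset {Y Z X : Set P} (hX : IsSubspace C X) (hY : Y ⊆ X) (hZ : Z ⊆ X) :
    joinSet C Y Z ⊆ X := by
  rintro r ((h | h) | ⟨p, hp, q, hq, h⟩)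
  exacts [hY h, hZ h, hX.2 p (hY hp) q (hZ hq) r h]

lemma joinSet_comm (hC : IsCollinearityRel C) (Y Z : Set P) : joinSet C Y Z = joinSet C Z Y := by
  have key : ∀ Y Z : Set P, joinSet C Y Z ⊆ joinSet C Z Y := by
    rintro Y Z r ((h | h) | ⟨p, hp, q, hq, h⟩)
    exacts [subset_joinSet_right _ _ h, subset_joinSet_left _ _ h,
      mem_joinSet_of_collinear hq hp (hC.swap _ _ _ h)]
  exact (key Y Z).antisymm (key Z Y)

/-- A line through a point of `joinSet C Y Z` and a point of `Z` stays in `joinSet C Y Z`. -/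
lemma IsPPIP.mem_joinSet_of_mem_right (hP : IsPPIP inc C) {X Y Z : Set P} (hX : IsSubspace C X)
    (hcons : Consistent inc X) (hY : IsSubspace C Y) (hZ : IsSubspace C Z) (hYX : Y ⊆ X)
    (hZX : Z ⊆ X) {u v r : P} (hu : u ∈ joinSet C Y Z) (hv : v ∈ Z) (h : C u v r) :
    r ∈ joinSet C Y Z := by
  have hC := hP.collinearity
  have huX : u ∈ X := joinSet_subset hX hYX hZX hu
  rcases hu with (hu | hu) | ⟨y, hy, z, hz, hyz⟩
  · exact mem_joinSet_of_collinear hu hv h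
  · exact subset_joinSet_right _ _ (hZ.2 u hu v hv r h)
  -- In every alternative of the triangle axiom `r` is joined to a point of `Y` or to one of `Z`.
  rcases hP.weakTriangle z v u y r (hC.rotate _ _ _ hyz) (hC.swap _ _ _ h) (hcons.mono (by
      rintro _ (rfl | rfl | rfl | rfl | rfl)
      exacts [hZX hz, hZX hv, huX, hYX hy, hX.2 _ huX _ (hZX hv) _ h])) with
    ⟨x, hx1, hx2, -⟩ | ⟨a, ha, k⟩ | k | ⟨a, p, ha, hp, k⟩ | k | k
  · exact mem_joinSet_of_collinear hy (hZ.2 z hz v hv x hx1) (hC.swap_right hx2)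
  · exact subset_joinSet_right _ _ (hZ.2 v hv a (hZ.1 ha hz) r (hC.swap_right k))
  · exact mem_joinSet_of_collinear hy hv (hC.rotate' k)
  · exact mem_joinSet_of_collinear (hY.1 hp hy) (hZ.1 ha hz)
      (hC.swap _ _ _ (hC.rotate _ _ _ k))
  · exact subset_joinSet_right _ _ (hZ.1 k hz)
  · exact subset_joinSet_left _ _ (hY.1 k hy)

lemma IsPPIP.mem_joinSet_of_mem_left (hP : IsPPIP inc C) {X Y Z : Set P} (hX : IsSubspace C X)
    (hcons : Consistent inc X) (hY : IsSubspace C Y) (hZ : IsSubspace C Z) (hYX : Y ⊆ X)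
    (hZX : Z ⊆ X) {u v r : P} (hu : u ∈ joinSet C Y Z) (hv : v ∈ Y) (h : C u v r) :
    r ∈ joinSet C Y Z := by
  rw [joinSet_comm hP.collinearity] at hu ⊢
  exact hP.mem_joinSet_of_mem_right hX hcons hZ hY hZX hYX hu hv h

/-- Inside a consistent subspace, the join of two subspaces is the union of the lines that connect
them. -/
theorem IsPPIP.isSubspace_joinSet (hP : IsPPIP inc C) {X Y Z : Set P} (hX : IsSubspace C X)
    (hcons : Consistent inc X) (hY : IsSubspace C Y) (hZ : IsSubspace C Z) (hYX : Y ⊆ X)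
    (hZX : Z ⊆ X) : IsSubspace C (joinSet C Y Z) := by
  have hC := hP.collinearity
  constructor
  · rintro r r' hr ((h | h) | ⟨p, hp, q, hq, h⟩)
    · exact subset_joinSet_left _ _ (hY.1 hr h)
    · exact subset_joinSet_right _ _ (hZ.1 hr h)
    by_cases hrp : r' ≤ p
    · exact subset_joinSet_left _ _ (hY.1 hrp hp)
    by_cases hrq : r' ≤ q
    · exact subset_joinSet_right _ _ (hZ.1 hrq hq)
    obtain ⟨p', q', hp', hq', h'⟩ := hP.regularity p q r r' h hr hrp hrq
    exact mem_joinSet_of_collinear (hY.1 hp' hp) (hZ.1 hq' hq) h'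
  · intro u hu v hv r h
    have hl : ∀ {u v r}, u ∈ joinSet C Y Z → v ∈ Y → C u v r → r ∈ joinSet C Y Z :=
      hP.mem_joinSet_of_mem_left hX hcons hY hZ hYX hZX
    have hr : ∀ {u v r}, u ∈ joinSet C Y Z → v ∈ Z → C u v r → r ∈ joinSet C Y Z :=
      hP.mem_joinSet_of_mem_right hX hcons hY hZ hYX hZX
    have huX : u ∈ X := joinSet_subset hX hYX hZX hu
    have hvX : v ∈ X := joinSet_subset hX hYX hZX hv
    rcases hv with (hv | hv) | ⟨y, hy, z, hz, hyz⟩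
    · exact hl hu hv h
    · exact hr hu hv h
    -- The triangle axiom leads from `r` to a line that meets `Y` or `Z`.
    rcases hP.weakTriangle y u v z r (hC.swap_right hyz) h (hcons.mono (by
        rintro _ (rfl | rfl | rfl | rfl | rfl)
        exacts [hYX hy, huX, hvX, hZX hz, hX.2 _ huX _ hvX _ h])) with
      ⟨x, hx1, hx2, -⟩ | ⟨a, ha, k⟩ | k | ⟨a, p, ha, hp, k⟩ | k | k
    · exact hr (hl hu hy (hC.swap _ _ _ hx1)) hz (hC.rotate' hx2)
    · exact hl hu (hY.1 ha hy) (hC.swap_right k)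
    · exact hr hu hz (hC.swap_right k)
    · exact mem_joinSet_of_collinear (hY.1 ha hy) (hZ.1 hp hz) (hC.rotate _ _ _ k)
    · exact subset_joinSet_left _ _ (hY.1 k hy)
    · exact subset_joinSet_right _ _ (hZ.1 k hz)

/-! ### The semilattice of consistent subspaces -/

lemma IsPPIP.exists_isLUB_csub_iff (hP : IsPPIP inc C) {Y Z : Csub inc C} :
    (∃ s, IsLUB {Y, Z} s) ↔ ∀ y ∈ Y.1, ∀ z ∈ Z.1, ¬ inc y z := by
  constructor
  · rintro ⟨s, hs⟩ y hy z hz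
    rw [isLUB_pair_iff] at hs
    exact s.2.2 y (hs.1 hy) z (hs.2.1 hz)
  · intro h
    have hcons : Consistent inc (Y.1 ∪ Z.1) := by
      rintro x (hx | hx) y (hy | hy)
      exacts [Y.2.2 x hx y hy, h x hx y hy, fun hxy => h y hy x hx (hP.inconsistency.symm _ _ hxy),
        Z.2.2 x hx y hy]
    refine ⟨⟨subspaceSpan C (Y.1 ∪ Z.1), isSubspace_span _, hP.consistent_span hcons⟩,
      isLUB_pair_iff.2 ⟨?_, ?_, fun U hY hZ => ?_⟩⟩
    · exact Set.subset_union_left.trans (subset_span _)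
    · exact Set.subset_union_right.trans (subset_span _)
    · exact span_subset U.2.1 (Set.union_subset hY hZ)

lemma IsPPIP.eq_joinSet_of_isLUB (hP : IsPPIP inc C) {Y Z s : Csub inc C}
    (hs : IsLUB {Y, Z} s) : s.1 = joinSet C Y.1 Z.1 := by
  rw [isLUB_pair_iff] at hs
  have hsub : joinSet C Y.1 Z.1 ⊆ s.1 := joinSet_subset s.2.1 hs.1 hs.2.1
  refine Set.Subset.antisymm ?_ hsub
  exact hs.2.2 ⟨joinSet C Y.1 Z.1, hP.isSubspace_joinSet s.2.1 s.2.2 Y.2.1 Z.2.1 hs.1 hs.2.1,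
    s.2.2.mono hsub⟩ (subset_joinSet_left _ _) (subset_joinSet_right _ _)

lemma IsPPIP.isModularLatticeOrder_Iic (hP : IsPPIP inc C) (X : Csub inc C) :
    IsModularLatticeOrder (Set.Iic X) := by
  let I : Lattice (Set.Iic X) :=
    { (inferInstance : PartialOrder (Set.Iic X)) with
      sup := fun Y Z => ⟨⟨joinSet C Y.1.1 Z.1.1,
          hP.isSubspace_joinSet X.2.1 X.2.2 Y.1.2.1 Z.1.2.1 Y.2 Z.2,
          X.2.2.mono (joinSet_subset X.2.1 Y.2 Z.2)⟩, joinSet_subset X.2.1 Y.2 Z.2⟩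
      inf := fun Y Z => ⟨⟨Y.1.1 ∩ Z.1.1, isSubspace_inter Y.1.2.1 Z.1.2.1,
          X.2.2.mono (Set.inter_subset_left.trans Y.2)⟩, Set.inter_subset_left.trans Y.2⟩
      le_sup_left := fun Y Z => subset_joinSet_left Y.1.1 Z.1.1
      le_sup_right := fun Y Z => subset_joinSet_right Y.1.1 Z.1.1
      sup_le := fun Y Z W hY hZ => joinSet_subset W.1.2.1 hY hZ
      inf_le_left := fun Y Z => (Set.inter_subset_left : Y.1.1 ∩ Z.1.1 ⊆ _)
      inf_le_right := fun Y Z => (Set.inter_subset_right : Y.1.1 ∩ Z.1.1 ⊆ _)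
      le_inf := fun Y Z W hZ hW => (Set.subset_inter hZ hW : Y.1.1 ⊆ _) }
  refine ⟨I, rfl, ⟨fun {A} B {D} hAD => ?_⟩⟩
  change joinSet C A.1.1 B.1.1 ∩ D.1.1 ⊆ joinSet C A.1.1 (B.1.1 ∩ D.1.1)
  have hAD' : A.1.1 ⊆ D.1.1 := hAD
  rintro r ⟨(h | h) | ⟨p, hp, q, hq, h⟩, hr⟩
  · exact subset_joinSet_left _ _ h
  · exact subset_joinSet_right _ _ ⟨h, hr⟩
  · exact mem_joinSet_of_collinear hp
      ⟨hq, D.1.2.1.2 p (hAD' hp) r hr q (hP.collinearity.swap_right h)⟩ h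

theorem IsPPIP.isModularSemilattice_csub (hP : IsPPIP inc C) :
    IsModularSemilattice (Csub inc C) where
  nonempty := ⟨⟨∅, isSubspace_empty, fun _ hx => hx.elim⟩⟩
  exists_inf X Y := ⟨⟨X.1 ∩ Y.1, isSubspace_inter X.2.1 Y.2.1,
    X.2.2.mono Set.inter_subset_left⟩, by
      refine ⟨?_, fun U hU => ?_⟩
      · rintro Z (rfl | rfl)
        exacts [fun _ h => h.1, fun _ h => h.2]
      · have h1 : U ≤ X := hU (by simp)
        have h2 : U ≤ Y := hU (by simp)
        exact (Set.subset_inter h1 h2 : U.1 ⊆ _)⟩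
  principal_modular := hP.isModularLatticeOrder_Iic
  exists_sup₃ X Y Z hXY hYZ hZX := by
    rw [hP.exists_isLUB_csub_iff] at hXY hYZ hZX
    have hs := hP.inconsistency.symm
    have hcons : Consistent inc (X.1 ∪ Y.1 ∪ Z.1) := by
      rintro x ((hx | hx) | hx) y ((hy | hy) | hy)
      exacts [X.2.2 x hx y hy, hXY x hx y hy, fun h => hZX y hy x hx (hs _ _ h),
        fun h => hXY y hy x hx (hs _ _ h), Y.2.2 x hx y hy, hYZ x hx y hy,
        hZX x hx y hy, fun h => hYZ y hy x hx (hs _ _ h), Z.2.2 x hx y hy]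
    refine ⟨⟨subspaceSpan C (X.1 ∪ Y.1 ∪ Z.1), isSubspace_span _, hP.consistent_span hcons⟩, ?_,
      fun U hU => ?_⟩
    · have h := subset_span (C := C) (X.1 ∪ Y.1 ∪ Z.1)
      rintro W (rfl | rfl | rfl)
      exacts [fun x hx => h (Or.inl (Or.inl hx)), fun x hx => h (Or.inl (Or.inr hx)),
        fun x hx => h (Or.inr hx)]
    · have h1 : X ≤ U := hU (by simp)
      have h2 : Y ≤ U := hU (by simp)
      have h3 : Z ≤ U := hU (by simp)
      exact span_subset U.2.1 (Set.union_subset (Set.union_subset h1 h2) h3)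

/-! ### The join-irreducible consistent subspaces -/

/-- The principal ideal of `p`, as a consistent subspace. -/
def IsPPIP.principal (hP : IsPPIP inc C) (p : P) : Csub inc C :=
  ⟨Set.Iic p, hP.collinearity.isSubspace_Iic p, hP.consistent_Iic p⟩

lemma IsPPIP.principal_le_iff (hP : IsPPIP inc C) {p : P} {X : Csub inc C} :
    hP.principal p ≤ X ↔ p ∈ X.1 :=
  ⟨fun h => h (le_refl p), fun h _ hq => X.2.1.1 hq h⟩

lemma isBot_csub_iff {X : Csub inc C} : IsBot X ↔ X.1 = ∅ := by
  refine ⟨fun h => ?_, fun h Y => ?_⟩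
  · exact Set.subset_empty_iff.1 (h ⟨∅, isSubspace_empty, fun _ hx => hx.elim⟩)
  · change X.1 ⊆ Y.1
    simp [h]

lemma IsPPIP.isJoinIrred_principal (hP : IsPPIP inc C) (p : P) :
    IsJoinIrred (hP.principal p) := by
  refine ⟨fun h => ?_, fun Y Z h => ?_⟩
  · have h' : p ∈ (hP.principal p).1 := le_refl p
    rw [isBot_csub_iff.1 h] at h'
    exact h'
  · have hp : p ∈ joinSet C Y.1 Z.1 := hP.eq_joinSet_of_isLUB h ▸ le_refl p
    rw [isLUB_pair_iff] at h
    rcases hp with (hp | hp) | ⟨y, hy, z, hz, hC⟩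
    · exact Or.inl (le_antisymm (hP.principal_le_iff.2 hp) h.1)
    · exact Or.inr (le_antisymm (hP.principal_le_iff.2 hp) h.2.1)
    · exact absurd (h.1 hy) (hP.collinearity.ct1 _ _ _ hC).2.2.2

lemma IsCollinearityRel.le_of_mem_joinSet (hC : IsCollinearityRel C) {a b t : P}
    (h : t ∈ joinSet C (Set.Iic a) (Set.Iic b)) (hb : b < t) : t ≤ a := by
  rcases h with (h | h) | ⟨x, -, y, hy, h⟩
  · exact h
  · exact absurd (hb.trans_le h) (lt_irrefl b)
  · exact absurd (le_trans hy hb.le) (hC.ct1 _ _ _ h).2.1.1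

/-- In the situation of the regularity axiom, a proper decrease of `p` forces a proper decrease of
`q₁`. -/
lemma IsPPIP.not_collinear_of_lt (hP : IsPPIP inc C) {X : Set P} (hX : IsSubspace C X)
    (hcons : Consistent inc X) {q₁ q₂ q₂' p p' : P} (hq₁ : q₁ ∈ X) (hq₂ : q₂ ∈ X)
    (h : C q₁ q₂ p) (hp : p' < p) (hq : q₂' ≤ q₂) : ¬ C q₁ q₂' p' := by
  intro h'
  have hC := hP.collinearity
  have hpX : p ∈ X := hX.2 _ hq₁ _ hq₂ _ h
  have hI : ∀ {a}, a ∈ X → Set.Iic a ⊆ X := fun ha _ hx => hX.1 hx ha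
  have hJ : ∀ {a b}, a ∈ X → b ∈ X → IsSubspace C (joinSet C (Set.Iic a) (Set.Iic b)) :=
    fun ha hb => hP.isSubspace_joinSet hX hcons (hC.isSubspace_Iic _) (hC.isSubspace_Iic _)
      (hI ha) (hI hb)
  obtain ⟨i1, i2, i3⟩ := hC.ct1 _ _ _ h
  rcases hq.lt_or_eq with hlt | rfl
  · have hJ' := hJ hpX (hX.1 hq hq₂)
    have h1 : q₁ ∈ joinSet C (Set.Iic p) (Set.Iic q₂') :=
      mem_joinSet_of_collinear hp.le (le_refl q₂') (hC.swap _ _ _ (hC.rotate _ _ _ h'))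
    have h2 := hJ'.2 q₁ h1 p (subset_joinSet_left _ _ (le_refl p)) q₂ (hC.swap_right h)
    exact i2.1 (hC.le_of_mem_joinSet h2 hlt)
  · have hJ' := hJ hq₁ (hX.1 hp.le hpX)
    have h1 : q₂' ∈ joinSet C (Set.Iic q₁) (Set.Iic p') :=
      mem_joinSet_of_collinear (le_refl q₁) (le_refl p') (hC.swap_right h')
    have h2 := hJ'.2 q₁ (subset_joinSet_left _ _ (le_refl q₁)) q₂' h1 p h
    exact i3.1 (hC.le_of_mem_joinSet h2 hp)

/-- Hence the elements of bounded height in a consistent subspace form a subspace. -/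
lemma IsPPIP.height_le_max (hP : IsPPIP inc C) (hwf : WellFoundedLT P) {X : Set P}
    (hX : IsSubspace C X) (hcons : Consistent inc X) (p : P) : ∀ {q₁ q₂ : P}, q₁ ∈ X → q₂ ∈ X →
    C q₁ q₂ p → Order.height p ≤ max (Order.height q₁) (Order.height q₂) := by
  have hC := hP.collinearity
  induction p using WellFoundedLT.induction with
  | ind p ih =>
    intro q₁ q₂ hq₁ hq₂ h
    obtain ⟨i1, i2, i3⟩ := hC.ct1 _ _ _ h
    rw [Order.height_eq_iSup_lt_height, iSup₂_le_iff]
    intro p' hp'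
    by_cases h1 : p' ≤ q₁
    · refine le_max_of_le_left (Order.height_add_one_le (lt_of_le_of_ne h1 ?_))
      rintro rfl
      exact i3.2 hp'.le
    by_cases h2 : p' ≤ q₂
    · refine le_max_of_le_right (Order.height_add_one_le (lt_of_le_of_ne h2 ?_))
      rintro rfl
      exact i2.1 hp'.le
    obtain ⟨q₁', q₂', h₁, h₂, h'⟩ := hP.regularity _ _ _ _ h hp'.le h1 h2
    have hlt₁ : q₁' < q₁ := lt_of_le_of_ne h₁ (by
      rintro rfl
      exact hP.not_collinear_of_lt hX hcons hq₁ hq₂ h hp' h₂ h')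
    have hlt₂ : q₂' < q₂ := lt_of_le_of_ne h₂ (by
      rintro rfl
      exact hP.not_collinear_of_lt hX hcons hq₂ hq₁ (hC.swap _ _ _ h) hp' h₁ (hC.swap _ _ _ h'))
    rcases le_max_iff.1 (ih p' hp' (hX.1 h₁ hq₁) (hX.1 h₂ hq₂) h') with k | k
    · exact le_max_of_le_left ((add_le_add_left k 1).trans (Order.height_add_one_le hlt₁))
    · exact le_max_of_le_right ((add_le_add_left k 1).trans (Order.height_add_one_le hlt₂))

/-- Take `p ∈ X` of maximal height and a subspace `Z` of `X` that is maximal among those that avoid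
`p` and contain all elements of smaller height. Then `X` is the join of `Z` and the principal ideal
of `p`. -/
theorem IsPPIP.exists_eq_principal (hP : IsPPIP inc C) (hfin : FiniteRank P) {X : Csub inc C}
    (hirr : IsJoinIrred X) : ∃ p, hP.principal p = X := by
  have hC := hP.collinearity
  obtain ⟨X, hX, hcons⟩ := X
  have hne : X.Nonempty := by
    rw [Set.nonempty_iff_ne_empty]
    exact fun h => hirr.1 (isBot_csub_iff.2 h)
  obtain ⟨p, hp, hmax⟩ := hfin.exists_height_max hne
  set B : Set P := {x | x ∈ X ∧ Order.height x < Order.height p} with hB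
  have hBs : IsSubspace C B := by
    refine ⟨fun x y hyx hx => ⟨hX.1 hyx hx.1, (Order.height_mono hyx).trans_lt hx.2⟩,
      fun x hx y hy r h => ⟨hX.2 x hx.1 y hy.1 r h, ?_⟩⟩
    exact (hP.height_le_max hfin.wellFoundedLT hX hcons r hx.1 hy.1 h).trans_lt
      (max_lt hx.2 hy.2)
  obtain ⟨Z, hBZ, hZmax⟩ := zorn_subset_nonempty
    {Z : Set P | IsSubspace C Z ∧ Z ⊆ X ∧ p ∉ Z} (fun c hc hchain _ => by
      refine ⟨⋃₀ c, ⟨⟨isLowerSet_sUnion fun Z hZ => (hc hZ).1.1, ?_⟩,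
        Set.sUnion_subset fun Z hZ => (hc hZ).2.1, ?_⟩, fun Z hZ => Set.subset_sUnion_of_mem hZ⟩
      · rintro x ⟨Z, hZ, hx⟩ y ⟨W, hW, hy⟩ r h
        rcases hchain.total hZ hW with hle | hle
        · exact ⟨W, hW, (hc hW).1.2 x (hle hx) y hy r h⟩
        · exact ⟨Z, hZ, (hc hZ).1.2 x hx y (hle hy) r h⟩
      · rintro ⟨Z, hZ, hpZ⟩
        exact (hc hZ).2.2 hpZ) B ⟨hBs, fun x hx => hx.1, fun h => lt_irrefl _ h.2⟩
  obtain ⟨hZ, hZX, hpZ⟩ := hZmax.prop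
  have hXj : X ⊆ joinSet C Z (Set.Iic p) := by
    intro r hr
    by_cases hrZ : r ∈ Z
    · exact subset_joinSet_left _ _ hrZ
    have hrX : Set.Iic r ⊆ X := fun x hx => hX.1 hx hr
    have hpr : p ∈ joinSet C Z (Set.Iic r) := by
      by_contra hno
      exact hrZ (hZmax.le_of_ge ⟨hP.isSubspace_joinSet hX hcons hZ (hC.isSubspace_Iic r) hZX hrX,
        joinSet_subset hX hZX hrX, hno⟩ (subset_joinSet_left _ _)
        (subset_joinSet_right _ _ (le_refl r)))
    rcases hpr with (h | h) | ⟨z, hz, r', hr', h⟩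
    · exact absurd h hpZ
    · rcases (show p ≤ r from h).lt_or_eq with hlt | rfl
      · exact absurd (Order.height_strictMono hlt (hfin.height_lt_top p)) (hmax r hr).not_gt
      · exact subset_joinSet_right _ _ (le_refl p)
    · rcases (show r' ≤ r from hr').lt_or_eq with hlt | rfl
      · have hr'B : r' ∈ B := ⟨hrX hr',
          (Order.height_strictMono hlt (hfin.height_lt_top r')).trans_le (hmax r hr)⟩
        exact absurd (hZ.2 z hz r' (hBZ hr'B) p h) hpZ
      · exact mem_joinSet_of_collinear hz (le_refl p) (hC.swap_right h)
  have hpX : hP.principal p ≤ ⟨X, hX, hcons⟩ := hP.principal_le_iff.2 hp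
  rcases hirr.2 ⟨Z, hZ, hcons.mono hZX⟩ (hP.principal p) (isLUB_pair_iff.2 ⟨hZX, hpX,
    fun U h1 h2 => hXj.trans (joinSet_subset U.2.1 h1 h2)⟩) with h | h
  · have h' : X = Z := congrArg Subtype.val h
    exact absurd (h' ▸ hp) hpZ
  · exact ⟨p, h.symm⟩

/-! ### Recovering the relations -/

lemma IsPPIP.inc_iff (hP : IsPPIP inc C) {p q : P} :
    inc p q ↔ ¬ ∃ s, IsLUB {hP.principal p, hP.principal q} s := by
  rw [hP.exists_isLUB_csub_iff]
  refine ⟨fun h hno => hno p (le_refl p) q (le_refl q) h, fun h => ?_⟩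
  by_contra hpq
  exact h fun x hx y hy hxy => hpq (hP.inconsistency.ic2 _ _ _ _ hxy hx hy)

lemma IsPPIP.isLUB_of_collinear (hP : IsPPIP inc C) {p q r : P} {s : Csub inc C}
    (h : C p q r) (hs : s.1 = subspaceSpan C {p, q, r}) :
    IsLUB {hP.principal p, hP.principal q} s := by
  have hsub : ({p, q, r} : Set P) ⊆ s.1 := hs ▸ subset_span _
  refine isLUB_pair_iff.2 ⟨hP.principal_le_iff.2 (hsub (by simp)),
    hP.principal_le_iff.2 (hsub (by simp)), fun U hp hq => ?_⟩
  rw [hP.principal_le_iff] at hp hq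
  change s.1 ⊆ U.1
  rw [hs]
  refine span_subset U.2.1 ?_
  rintro x (rfl | rfl | rfl)
  exacts [hp, hq, U.2.1.2 p hp q hq x h]

/-- If the principal ideals of `p, q, r` have equal pairwise joins and `C p' q' r` with `p' ≤ p` and
`q' ≤ q`, then `p' = p`. -/
lemma IsPPIP.eq_of_collinear_of_le (hP : IsPPIP inc C) {p q r p' q' : P} {s : Csub inc C}
    (hpq : ¬ p ≤ q) (h1 : IsLUB {hP.principal p, hP.principal q} s)
    (h2 : IsLUB {hP.principal q, hP.principal r} s) (hp' : p' ≤ p) (hq' : q' ≤ q)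
    (h : C p' q' r) : p' = p := by
  have hC := hP.collinearity
  have h1' := isLUB_pair_iff.1 h1
  have hps : p ∈ s.1 := hP.principal_le_iff.1 h1'.1
  have hqs : q ∈ s.1 := hP.principal_le_iff.1 h1'.2.1
  by_contra hne
  have hlt : p' < p := lt_of_le_of_ne hp' hne
  have hI : ∀ {a}, a ∈ s.1 → Set.Iic a ⊆ s.1 := fun ha _ hx => s.2.1.1 hx ha
  have hp's : p' ∈ s.1 := s.2.1.1 hp' hps
  have hJ := hP.isSubspace_joinSet s.2.1 s.2.2 (hC.isSubspace_Iic q) (hC.isSubspace_Iic p')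
    (hI hqs) (hI hp's)
  have hr : r ∈ joinSet C (Set.Iic q) (Set.Iic p') :=
    mem_joinSet_of_collinear hq' (le_refl p') (hC.swap _ _ _ h)
  have hsJ : s.1 ⊆ joinSet C (Set.Iic q) (Set.Iic p') := by
    rw [hP.eq_joinSet_of_isLUB h2]
    exact joinSet_subset hJ (subset_joinSet_left _ _) fun x hx => hJ.1 hx hr
  exact hpq (hC.le_of_mem_joinSet (hsJ hps) hlt)

lemma IsPPIP.principal_le_principal_iff (hP : IsPPIP inc C) {p q : P} :
    hP.principal p ≤ hP.principal q ↔ p ≤ q := hP.principal_le_iff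

lemma IsPPIP.collinear_principal_iff (hP : IsPPIP inc C) {p q r : P} :
    C p q r ↔ Collinear (hP.principal p) (hP.principal q) (hP.principal r) := by
  have hC := hP.collinearity
  unfold Collinear Incomp
  simp only [hP.principal_le_principal_iff]
  constructor
  · intro h
    let s : Csub inc C :=
      ⟨subspaceSpan C {p, q, r}, isSubspace_span _, hP.consistent_span (hP.cc1 p q r h)⟩
    refine ⟨hC.ct1 p q r h, s, hP.isLUB_of_collinear h rfl,
      hP.isLUB_of_collinear (hC.rotate _ _ _ h) (congrArg (subspaceSpan C) ?_),
      hP.isLUB_of_collinear (hC.rotate' h) (congrArg (subspaceSpan C) ?_)⟩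
    · ext; simp; tauto
    · ext; simp; tauto
  · rintro ⟨⟨i1, i2, i3⟩, s, h1, h2, h3⟩
    have hr : r ∈ joinSet C (Set.Iic p) (Set.Iic q) := by
      have := hP.principal_le_iff.1 (isLUB_pair_iff.1 h2).2.1
      rwa [hP.eq_joinSet_of_isLUB h1] at this
    rcases hr with (h | h) | ⟨p', hp', q', hq', h⟩
    · exact absurd h i3.1
    · exact absurd h i2.2
    · obtain rfl := hP.eq_of_collinear_of_le i1.1 h1 h2 hp' hq' h
      rw [Set.pair_comm] at h1 h3
      obtain rfl := hP.eq_of_collinear_of_le i1.2 h1 h3 hq' hp' (hC.swap _ _ _ h)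
      exact h

theorem IsPPIP.exists_orderIso_irr (hP : IsPPIP inc C) (hfin : FiniteRank P) :
    ∃ f : P ≃o Irr (Csub inc C),
      (∀ p : P, (f p).1.1 = Set.Iic p) ∧
      (∀ p q : P, inc p q ↔ irrInc (f p) (f q)) ∧
      (∀ p q r : P, C p q r ↔ irrColl (f p) (f q) (f r)) := by
  let g : P ↪o Irr (Csub inc C) := OrderEmbedding.ofMapLEIff
    (fun p => ⟨hP.principal p, hP.isJoinIrred_principal p⟩)
    fun _ _ => hP.principal_le_principal_iff
  refine ⟨RelIso.ofSurjective g fun X => ?_, fun p => rfl, fun p q => hP.inc_iff,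
    fun p q r => hP.collinear_principal_iff⟩
  obtain ⟨p, hp⟩ := hP.exists_eq_principal hfin X.2
  exact ⟨p, Subtype.ext hp⟩

end Subspaces

end PPIP

theorem mainTheorem1 :
    (∀ (L : Type u) [PartialOrder L], PPIP.IsModularSemilattice L → PPIP.FiniteRank L →
      PPIP.IsPPIP (PPIP.irrInc (L := L)) (PPIP.irrColl (L := L)) ∧
      PPIP.FiniteRank (PPIP.Irr L) ∧
      ∃ φ : L ≃o PPIP.Csub (PPIP.irrInc (L := L)) (PPIP.irrColl (L := L)),
        (∀ l : L, (φ l).1 = {p : PPIP.Irr L | p.1 ≤ l}) ∧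
        (∀ I, IsLUB (Subtype.val '' I.1 : Set L) (φ.symm I)) ∧
        (∀ I, I.1 = ∅ → IsBot (φ.symm I))) ∧
    (∀ (P : Type v) [PartialOrder P] (inc : P → P → Prop) (C : P → P → P → Prop),
      PPIP.IsPPIP inc C → PPIP.FiniteRank P →
      PPIP.IsModularSemilattice (PPIP.Csub inc C) ∧
      ∃ f : P ≃o PPIP.Irr (PPIP.Csub inc C),
        (∀ p : P, (f p).1.1 = Set.Iic p) ∧
        (∀ p q : P, inc p q ↔ PPIP.irrInc (f p) (f q)) ∧
        (∀ p q r : P, C p q r ↔ PPIP.irrColl (f p) (f q) (f r))) :=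
  ⟨fun _ _ hL hfin => ⟨hL.isPPIP hfin.wellFoundedLT, hfin.irr, hL.exists_orderIso_csub hfin⟩,
    fun _ _ _ _ hP hfin => ⟨hP.isModularSemilattice_csub, hP.exists_orderIso_irr hfin⟩⟩
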